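/- Consider one of the following three cases: (A) $B=\mathbb C$, $V=\mathbb C^N$ and $(\,,)$ is a non-degenerate Hermitian form on $V$ (of any signature $(p,q)$); (B) $B=\mathbb R$, $V=\mathbb R^N$ and $(\,,)$ is a symplectic form; (C) $B=\mathbb H$, $V=\mathbb H^N$, a right $\mathbb H$-vector space, and $(\,,)$ is a non-degenerate skew-Hermitian form. Forms satisfy $(vb,wc)=\bar b\,(v,w)\,c$. Let $G$ be the group of $B$-linear isometries of $V$, so that $G=\mathrm U(p,q)$, $\mathrm{Sp}(N,\mathbb R)$, $\mathrm O^*(2N)$ respectively. For a $B$-subspace $U\subseteq V$ on which $(\,,)$ is non-degenerate, let $U^\perp$ be its orthogonal complement, let $G(U)$ be the group of all $g\in G$ that fix $U^\perp$ pointwise, and let $D(U)$ be the symmetric space of $G(U)$, realised, with the topology of the Grassmannian, as follows. In case (A), $D(U)$ is the set of negative definite complex subspaces of $U$ of dimension $s$, where $(r,s)$ is the signature of $(\,,)|_U$. In case (B), let $S$ be the complex bilinear extension of $(\,,)$ to $V\otimes_{\mathbb R}\mathbb C$; then $D(U)$ is the set of complex subspaces $z\subseteq U\otimes_{\mathbb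 R}\mathbb C$ with $2\dim_{\mathbb C} z=\dim_{\mathbb R}U$, $S|_z=0$ and $iS(\bar v,w)$ negative definite on $z$. In case (C), regard $V$ as a complex vector space by right multiplication by $\mathbb C\subset\mathbb H$, write $H(v,w)=a+bi$ if $(v,w)=a+bi+cj+dk$, and $S(v,w)=H(vj,w)$; then $D(U)$ is the set of complex subspaces $z\subseteq U$ with $2\dim_{\mathbb C} z=\dim_{\mathbb C}U$, $S|_z=0$ and $iH$ negative definite on $z$. Put $D=D(V)$ and $D_U=D(U^\perp)$. Let $\Gamma$ be a subgroup of $G$, and put $\Gamma_U=\Gamma\cap G(U^\perp)$. For $z'\in D(U)$ let $$\rho_{U,z'}:\Gamma_U\backslash D_U\to\Gamma\backslash D$$ be the map induced by $z\mapsto z'\oplus z$. If $\mu\in H_n(\Gamma_U\backslash D_U;\mathbb Z)$ is a fundamental class, that is, a class that restricts to a generator of the infinite cyclic group $H_n(X,X\smallsetminus\{x\};\mathbb Z)$ at every point $x$ of $X=\Gamma_U\backslash D_U$ (such a class exists when $\Gamma_U\backslash D_U$ is a compact complex manifold, as it is for the neat arithmetic groups $\Gamma$, and rational $U$, that define generalized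 special cycles), the homology class of the generalized special cycle is $$[C_{U,z'}]=(\rho_{U,z'})_*\,\mu\in H_n(\Gamma\backslash D;\mathbb Z).$$ Then $[C_{U,z'}]$ does not depend on the choice of $z'$: for all $z',z''\in D(U)$ and every fundamental class $\mu$ of $\Gamma_U\backslash D_U$, $$(\rho_{U,z'})_*\,\mu=(\rho_{U,z''})_*\,\mu .$$ Moreover, for every $n$ and every coefficient group $A$, the maps $(\rho_{U,z'})_*,(\rho_{U,z''})_*:H_n(\Gamma_U\backslash D_U;A)\to H_n(\Gamma\backslash D;A)$ coincide. -/

import Mathlib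

open CategoryTheory
open scoped Matrix Quaternion

namespace SpecialCycle

noncomputable section

/-! ### Grassmannians -/

section Grassmannian

variable (W : Type) [AddCommGroup W] [Module ℂ W]

/-- Linearly independent finite tuples of vectors of `W` (the disjoint union of the Stiefel
spaces of `d`-frames, over all `d`). -/
abbrev Frame : Type := Σ d : ℕ, {v : Fin d → W // LinearIndependent ℂ v}

/-- The complex subspaces of `W`: the disjoint union of the Grassmannians `Gr_d(W)`. -/
abbrev Gr : Type := Submodule ℂ W

variable {W}

/-- The subspace spanned by a frame. -/
def frameSpan (f : Frame W) : Gr W := Submodule.span ℂ (Set.range f.2.1)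

variable [TopologicalSpace W]

/-- The usual topology of the Grassmannian: the quotient topology from the space of frames. -/
instance : TopologicalSpace (Gr W) := TopologicalSpace.coinduced frameSpan inferInstance

end Grassmannian

/-! ### Quotients of sets of subspaces by groups -/

section Quotients

variable {W : Type} [AddCommGroup W] [Module ℂ W]
variable {𝒢 : Type} [Group 𝒢]

/-- Two points of a set `D` of subspaces are identified when an element of `Γ` maps one to
the other. -/
def orbitSetoid (act : 𝒢 →* Module.End ℂ W) (Γ : Subgroup 𝒢) (D : Set (Gr W)) : Setoid D where
  r z w := ∃ g ∈ Γ, Submodule.map (act g) z.1 = w.1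
  iseqv := by
    refine ⟨fun z => ⟨1, Γ.one_mem, ?_⟩, ?_, ?_⟩
    · rw [map_one]; exact Submodule.map_id _
    · rintro z w ⟨g, hg, h⟩
      refine ⟨g⁻¹, Γ.inv_mem hg, ?_⟩
      rw [← h, ← Submodule.map_comp, ← Module.End.mul_eq_comp, ← map_mul, inv_mul_cancel, map_one]
      exact Submodule.map_id _
    · rintro z w y ⟨g, hg, h⟩ ⟨g', hg', h'⟩
      refine ⟨g' * g, Γ.mul_mem hg' hg, ?_⟩
      rw [← h', ← h, ← Submodule.map_comp, ← Module.End.mul_eq_comp, ← map_mul]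

/-- The quotient `Γ \ D`, with the quotient topology when `W` is topologised. -/
abbrev LocSym (act : 𝒢 →* Module.End ℂ W) (Γ : Subgroup 𝒢) (D : Set (Gr W)) : Type :=
  Quotient (orbitSetoid act Γ D)

end Quotients

/-! ### Continuity of `z ↦ z' ⊕ z` -/

section Continuity

variable {W : Type} [AddCommGroup W] [Module ℂ W]

theorem frameSpan_surjective [FiniteDimensional ℂ W] :
    Function.Surjective (frameSpan : Frame W → Gr W) := by
  intro z
  let b := Module.finBasis ℂ (z : Submodule ℂ W)
  refine ⟨⟨_, fun i => (b i : W), ?_⟩, ?_⟩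
  · exact b.linearIndependent.map' (Submodule.subtype z) (Submodule.ker_subtype _)
  · change Submodule.span ℂ (Set.range fun i => (b i : W)) = z
    have h : (Set.range fun i => (b i : W)) = (Submodule.subtype z) '' Set.range b := by
      ext x; simp
    rw [h, Submodule.span_image, b.span_eq, Submodule.map_top, Submodule.range_subtype]

variable [TopologicalSpace W]

theorem frameSpan_isOpenQuotientMap [FiniteDimensional ℂ W] [ContinuousAdd W]
    [ContinuousConstSMul ℂ W] : IsOpenQuotientMap (frameSpan : Frame W → Gr W) := by
  refine ⟨frameSpan_surjective, continuous_coinduced_rng, ?_⟩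
  intro O hO
  change IsOpen (frameSpan ⁻¹' (frameSpan '' O))
  rw [isOpen_sigma_iff]
  intro d
  rw [isOpen_iff_forall_mem_open]
  rintro ⟨v, hv⟩ ⟨⟨d', w, hw⟩, hwO, hspan⟩
  change Submodule.span ℂ (Set.range w) = Submodule.span ℂ (Set.range v) at hspan
  have hd : d' = d := by
    have h1 := finrank_span_eq_card hw
    have h2 := finrank_span_eq_card hv
    rw [hspan, h2] at h1
    simpa using h1.symm
  subst hd
  have hmem : ∀ i, ∃ c : Fin d' → ℂ, ∑ j, c j • v j = w i := by
    intro i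
    have : w i ∈ Submodule.span ℂ (Set.range v) := by
      rw [← hspan]; exact Submodule.subset_span ⟨i, rfl⟩
    exact (Submodule.mem_span_range_iff_exists_fun ℂ).1 this
  choose c hc using hmem
  let T : (Fin d' → W) → (Fin d' → W) := fun u i => ∑ j, c i j • u j
  have hT : Continuous T := by
    refine continuous_pi fun i => continuous_finsetSum _ fun j _ => ?_
    exact (continuous_apply j).const_smul (c i j)
  have hmem' : ∀ i, ∃ e : Fin d' → ℂ, ∑ j, e j • w j = v i := by
    intro i
    have : v i ∈ Submodule.span ℂ (Set.range w) := by
      rw [hspan]; exact Submodule.subset_span ⟨i, rfl⟩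
    exact (Submodule.mem_span_range_iff_exists_fun ℂ).1 this
  choose e he using hmem'
  have hec : ∀ i k, ∑ j, e i j * c j k = if i = k then 1 else 0 := by
    intro i k
    have h : ∑ k, (∑ j, e i j * c j k) • v k = ∑ k, (if i = k then (1 : ℂ) else 0) • v k := by
      simp only [ite_smul, one_smul, zero_smul, Finset.sum_ite_eq, Finset.mem_univ, if_true]
      conv_rhs => rw [← he i]
      simp only [Finset.sum_smul, mul_smul]
      rw [Finset.sum_comm]
      refine Finset.sum_congr rfl fun j _ => ?_
      rw [← Finset.smul_sum, hc]
    have h3 := Fintype.linearIndependent_iff.1 hv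
      (fun k => (∑ j, e i j * c j k) - if i = k then 1 else 0) (by
        simp only [sub_smul, Finset.sum_sub_distrib]; rw [h, sub_self]) k
    exact sub_eq_zero.1 h3
  have hspanT : ∀ u : Fin d' → W,
      Submodule.span ℂ (Set.range (T u)) = Submodule.span ℂ (Set.range u) := by
    intro u
    apply le_antisymm
    · rw [Submodule.span_le]
      rintro _ ⟨i, rfl⟩
      exact Submodule.sum_mem _ fun j _ =>
        Submodule.smul_mem _ _ (Submodule.subset_span ⟨j, rfl⟩)
    · rw [Submodule.span_le]
      rintro _ ⟨i, rfl⟩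
      have : u i = ∑ j, e i j • T u j := by
        simp only [T, Finset.smul_sum, smul_smul]
        rw [Finset.sum_comm]
        simp only [← Finset.sum_smul, hec]
        simp
      rw [SetLike.mem_coe, this]
      exact Submodule.sum_mem _ fun j _ =>
        Submodule.smul_mem _ _ (Submodule.subset_span ⟨j, rfl⟩)
  have hindT : ∀ u : Fin d' → W, LinearIndependent ℂ u → LinearIndependent ℂ (T u) := by
    intro u hu
    rw [linearIndependent_iff_card_eq_finrank_span, Set.finrank, hspanT, finrank_span_eq_card hu]
  let T' : {u : Fin d' → W // LinearIndependent ℂ u} → {u : Fin d' → W // LinearIndependent ℂ u} :=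
    fun u => ⟨T u.1, hindT u.1 u.2⟩
  have hT' : Continuous T' := (hT.comp continuous_subtype_val).subtype_mk _
  refine ⟨T' ⁻¹' ((fun u => (⟨d', u⟩ : Frame W)) ⁻¹' O), ?_, ?_, ?_⟩
  · intro u hu
    exact ⟨_, hu, hspanT u.1⟩
  · exact ((isOpen_sigma_iff.1 hO) d').preimage hT'
  · change (⟨d', T' ⟨v, hv⟩⟩ : Frame W) ∈ O
    have : T' ⟨v, hv⟩ = ⟨w, hw⟩ := Subtype.ext (funext hc)
    rw [this]; exact hwO

theorem continuous_sup [FiniteDimensional ℂ W] [ContinuousAdd W]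
    [ContinuousConstSMul ℂ W] (D : Set (Gr W)) (z' : Submodule ℂ W)
    (hD : ∀ z ∈ D, Disjoint z' z) :
    Continuous (fun z : D => (z' ⊔ z.1)) := by
  obtain ⟨⟨m, b, hb⟩, hbz⟩ := frameSpan_surjective (W := W) z'
  change Submodule.span ℂ (Set.range b) = z' at hbz
  have hq : IsOpenQuotientMap (D.restrictPreimage (frameSpan : Frame W → Gr W)) :=
    frameSpan_isOpenQuotientMap.restrictPreimage D
  rw [hq.isQuotientMap.continuous_iff]
  have hind : ∀ f : frameSpan ⁻¹' D, LinearIndependent ℂ (Sum.elim b f.1.2.1) := by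
    intro f
    refine LinearIndependent.sum_type hb f.1.2.2 ?_
    rw [hbz]; exact hD _ f.2
  have hind' : ∀ f : frameSpan ⁻¹' D, LinearIndependent ℂ (Fin.append b f.1.2.1) := by
    intro f
    have : Fin.append b f.1.2.1 = Sum.elim b f.1.2.1 ∘ finSumFinEquiv.symm := by
      rw [Equiv.eq_comp_symm]
      exact Fin.append_comp_sumElim
    rw [this]
    exact (hind f).comp _ finSumFinEquiv.symm.injective
  let Φ : frameSpan ⁻¹' D → Frame W := fun f => ⟨m + f.1.1, Fin.append b f.1.2.1, hind' f⟩
  have hΦ : Continuous Φ := by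
    rw [continuous_iff_continuousAt]
    rintro ⟨⟨d, v⟩, hv⟩
    let P : Set {v : Fin d → W // LinearIndependent ℂ v} := 
      (fun u => (⟨d, u⟩ : Frame W)) ⁻¹' (frameSpan ⁻¹' D)
    let ι : P → frameSpan ⁻¹' D := fun u => ⟨⟨d, u.1⟩, u.2⟩
    have hι : Topology.IsOpenEmbedding ι := by
      have := (Topology.IsOpenEmbedding.sigmaMk
        (σ := fun d => {v : Fin d → W // LinearIndependent ℂ v}) (i := d)).restrictPreimage
        (frameSpan ⁻¹' D : Set (Frame W))
      exact this
    have hc : Continuous (Φ ∘ ι) := by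
      change Continuous fun u : P => (⟨m + d, Fin.append b u.1.1, hind' (ι u)⟩ : Frame W)
      refine continuous_sigmaMk.comp (Continuous.subtype_mk ?_ _)
      refine continuous_pi fun i => ?_
      refine Fin.addCases (fun j => ?_) (fun j => ?_) i
      · simp only [Fin.append_left]; exact continuous_const
      · simp only [Fin.append_right]
        exact (continuous_apply j).comp (continuous_subtype_val.comp continuous_subtype_val)
    exact (hι.continuousAt_iff (x := ⟨v, hv⟩)).1 hc.continuousAt
  have : ((fun z : D => (z' ⊔ z.1)) ∘
      D.restrictPreimage (frameSpan : Frame W → Gr W)) = frameSpan ∘ Φ := by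
    funext f
    change z' ⊔ Submodule.span ℂ (Set.range f.1.2.1) =
      Submodule.span ℂ (Set.range (Fin.append b f.1.2.1))
    rw [← hbz, ← Submodule.span_union]
    congr 1
    ext x
    constructor
    · rintro (⟨i, rfl⟩ | ⟨i, rfl⟩)
      · exact ⟨Fin.castAdd _ i, by simp⟩
      · exact ⟨Fin.natAdd _ i, by simp⟩
    · rintro ⟨i, rfl⟩
      refine Fin.addCases (fun j => ?_) (fun j => ?_) i
      · left; exact ⟨j, by simp⟩
      · right; exact ⟨j, by simp⟩
  rw [this]
  exact continuous_coinduced_rng.comp hΦ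

/-- The map `Γ' \ D' → Γ \ D` induced by `z ↦ z' ⊕ z`, where `Γ' ≤ Γ` fixes `z'`. -/
def sumMap [FiniteDimensional ℂ W] [ContinuousAdd W] [ContinuousConstSMul ℂ W]
    {𝒢 : Type} [Group 𝒢] (act : 𝒢 →* Module.End ℂ W) {Γ' Γ : Subgroup 𝒢} (hΓ : Γ' ≤ Γ)
    {D' D : Set (Gr W)} (z' : Submodule ℂ W)
    (hdisj : ∀ z ∈ D', Disjoint z' z)
    (hmem : ∀ z ∈ D', (z' ⊔ z) ∈ D)
    (hfix : ∀ g ∈ Γ', Submodule.map (act g) z' = z') :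
    C(LocSym act Γ' D', LocSym act Γ D) where
  toFun := Quotient.map (fun z => ⟨z' ⊔ z.1, hmem z.1 z.2⟩) (by
    rintro z w ⟨g, hg, h⟩
    refine ⟨g, hΓ hg, ?_⟩
    change Submodule.map (act g) (z' ⊔ z.1) = z' ⊔ w.1
    rw [Submodule.map_sup, hfix g hg, ← h])
  continuous_toFun := by
    refine Continuous.quotient_map' (f := fun z : D' => (⟨z' ⊔ z.1, hmem z.1 z.2⟩ : D)) ?_ _
    exact (continuous_sup D' z' hdisj).subtype_mk _

end Continuity

/-! ### Forms, isometry groups and orthogonal complements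

`B` is `ℂ`, `ℝ` or `ℍ`, and `V = B ^ N` is a right vector space over `B`. -/

theorem finrank_op_fun {B : Type} [DivisionRing B] (n : ℕ) : Module.finrank Bᵐᵒᵖ (Fin n → B) = n := by
  have h1 : Module.finrank Bᵐᵒᵖ B = 1 := by
    refine finrank_eq_one (1 : B) one_ne_zero fun w => ⟨MulOpposite.op w, by simp⟩
  have : Module.Finite Bᵐᵒᵖ B := Module.finite_of_finrank_pos (by omega)
  rw [Module.finrank_pi_fintype]
  simp [h1]

theorem finite_op_fun {B : Type} [DivisionRing B] (n : ℕ) : Module.Finite Bᵐᵒᵖ (Fin n → B) := by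
  have h1 : Module.finrank Bᵐᵒᵖ B = 1 := by
    refine finrank_eq_one (1 : B) one_ne_zero fun w => ⟨MulOpposite.op w, by simp⟩
  have : Module.Finite Bᵐᵒᵖ B := Module.finite_of_finrank_pos (by omega)
  infer_instance

section Forms

variable {B : Type} [DivisionRing B] [StarRing B] {N : ℕ}

/-- The form `(v, w) = ∑ᵢⱼ v̄ᵢ Qᵢⱼ wⱼ` on `B ^ N`; it satisfies `(v b, w c) = b̄ (v, w) c`. -/
def form (Q : Matrix (Fin N) (Fin N) B) (v w : Fin N → B) : B := star v ⬝ᵥ (Q *ᵥ w)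

/-- The group of `B`-linear isometries of the form. -/
def isometryGroup (Q : Matrix (Fin N) (Fin N) B) : Subgroup (Matrix (Fin N) (Fin N) B)ˣ where
  carrier := {g | ∀ v w, form Q (g.1 *ᵥ v) (g.1 *ᵥ w) = form Q v w}
  one_mem' := by intro v w; simp
  mul_mem' := by
    intro a b ha hb v w
    simp only [Units.val_mul, ← Matrix.mulVec_mulVec]
    rw [ha, hb]
  inv_mem' := by
    intro a ha v w
    have h := ha ((a⁻¹).1 *ᵥ v) ((a⁻¹).1 *ᵥ w)
    simp only [Matrix.mulVec_mulVec, Units.mul_inv, Matrix.one_mulVec] at h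
    exact h.symm

theorem form_add_right (Q : Matrix (Fin N) (Fin N) B) (v w w' : Fin N → B) :
    form Q v (w + w') = form Q v w + form Q v w' := by
  simp [form, Matrix.mulVec_add, dotProduct_add]

theorem form_add_left (Q : Matrix (Fin N) (Fin N) B) (v v' w : Fin N → B) :
    form Q (v + v') w = form Q v w + form Q v' w := by
  simp [form, add_dotProduct]

theorem form_smul_right (Q : Matrix (Fin N) (Fin N) B) (v w : Fin N → B) (c : Bᵐᵒᵖ) :
    form Q v (c • w) = form Q v w * c.unop := by
  simp [form, Matrix.mulVec_smul, dotProduct_smul]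

theorem form_smul_left (Q : Matrix (Fin N) (Fin N) B) (v w : Fin N → B) (c : Bᵐᵒᵖ) :
    form Q (c • v) w = star c.unop * form Q v w := by
  simp [form, dotProduct, Finset.mul_sum, mul_assoc]

theorem form_star (Q : Matrix (Fin N) (Fin N) B) (v w : Fin N → B) :
    star (form Q v w) = form Qᴴ w v := by
  simp only [form, dotProduct, Matrix.mulVec, star_sum, star_mul, Finset.mul_sum,
    Pi.star_apply, star_star, Matrix.conjTranspose_apply]
  rw [Finset.sum_comm]
  simp only [mul_assoc]

/-- The orthogonal complement `U^⊥ = {w | (u, w) = 0 for all u ∈ U}`. -/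
def orth (Q : Matrix (Fin N) (Fin N) B) (U : Submodule Bᵐᵒᵖ (Fin N → B)) :
    Submodule Bᵐᵒᵖ (Fin N → B) where
  carrier := {w | ∀ u ∈ U, form Q u w = 0}
  zero_mem' := by intro u _; simp [form]
  add_mem' := by intro a b ha hb u hu; rw [form_add_right, ha u hu, hb u hu, add_zero]
  smul_mem' := by intro c a ha u hu; rw [form_smul_right, ha u hu, zero_mul]

/-- The restriction of the form to `U` is non-degenerate. -/
def Nondeg (Q : Matrix (Fin N) (Fin N) B) (U : Submodule Bᵐᵒᵖ (Fin N → B)) : Prop :=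
  ∀ w ∈ U, (∀ u ∈ U, form Q u w = 0) → w = 0

/-- `G(U)`: the isometries that fix every vector of `U^⊥`. -/
def groupOf (Q : Matrix (Fin N) (Fin N) B) (U : Submodule Bᵐᵒᵖ (Fin N → B)) :
    Subgroup (Matrix (Fin N) (Fin N) B)ˣ where
  carrier := {g | g ∈ isometryGroup Q ∧ ∀ v ∈ orth Q U, g.1 *ᵥ v = v}
  one_mem' := ⟨Subgroup.one_mem _, by intro v _; simp⟩
  mul_mem' := by
    rintro a b ⟨ha, ha'⟩ ⟨hb, hb'⟩
    refine ⟨Subgroup.mul_mem _ ha hb, fun v hv => ?_⟩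
    rw [Units.val_mul, ← Matrix.mulVec_mulVec, hb' v hv, ha' v hv]
  inv_mem' := by
    rintro a ⟨ha, ha'⟩
    refine ⟨Subgroup.inv_mem _ ha, fun v hv => ?_⟩
    conv_lhs => rw [← ha' v hv]
    rw [Matrix.mulVec_mulVec, Units.inv_mul, Matrix.one_mulVec]

/-- `Γ_U = Γ ∩ G(U^⊥)`. -/
def stab (Q : Matrix (Fin N) (Fin N) B) (Γ : Subgroup (Matrix (Fin N) (Fin N) B)ˣ)
    (U : Submodule Bᵐᵒᵖ (Fin N → B)) : Subgroup (Matrix (Fin N) (Fin N) B)ˣ :=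
  Γ ⊓ groupOf Q (orth Q U)

theorem form_eq_zero_symm {Q : Matrix (Fin N) (Fin N) B} (hQ : Qᴴ = Q ∨ Qᴴ = -Q)
    {v w : Fin N → B} (h : form Q v w = 0) : form Q w v = 0 := by
  have h1 := form_star Q v w
  rw [h, star_zero] at h1
  rcases hQ with hQ | hQ
  · rw [← hQ, ← h1]
  · rw [hQ] at h1
    have : form (-Q) w v = - form Q w v := by simp [form, Matrix.neg_mulVec]
    rw [this] at h1
    exact neg_eq_zero.1 h1.symm

theorem le_orth_orth {Q : Matrix (Fin N) (Fin N) B} (hQ : Qᴴ = Q ∨ Qᴴ = -Q)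
    (U : Submodule Bᵐᵒᵖ (Fin N → B)) : U ≤ orth Q (orth Q U) :=
  fun u hu _ hw => form_eq_zero_symm hQ (hw u hu)

theorem stab_fix {Q : Matrix (Fin N) (Fin N) B} (hQ : Qᴴ = Q ∨ Qᴴ = -Q)
    {Γ : Subgroup (Matrix (Fin N) (Fin N) B)ˣ} {U : Submodule Bᵐᵒᵖ (Fin N → B)}
    {g : (Matrix (Fin N) (Fin N) B)ˣ} (hg : g ∈ stab Q Γ U) {v : Fin N → B} (hv : v ∈ U) :
    g.1 *ᵥ v = v :=
  hg.2.2 v (le_orth_orth hQ U hv)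

/-- The splitting `V = U ⊕ U^⊥`. -/
theorem isCompl_orth {Q : Matrix (Fin N) (Fin N) B} {U : Submodule Bᵐᵒᵖ (Fin N → B)}
    (hU : Nondeg Q U) : IsCompl U (orth Q U) := by
  have := finite_op_fun (B := B) N
  have hdisj : Disjoint U (orth Q U) := by
    rw [Submodule.disjoint_def]
    exact fun w hw hw' => hU w hw hw'
  refine ⟨hdisj, ?_⟩
  let b := Module.finBasis Bᵐᵒᵖ U
  let L : (Fin N → B) →ₗ[Bᵐᵒᵖ] (Fin (Module.finrank Bᵐᵒᵖ U) → B) :=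
    { toFun := fun w i => form Q (b i) w
      map_add' := fun w w' => by ext i; simp [form_add_right]
      map_smul' := fun c w => by ext i; simp [form_smul_right] }
  have hker : LinearMap.ker L ≤ orth Q U := by
    intro w hw u hu
    have hw' : ∀ i, form Q (b i) w = 0 := fun i => congrFun hw i
    have hu' : u ∈ Submodule.span Bᵐᵒᵖ (Set.range fun i => (b i : Fin N → B)) := by
      have h : (Set.range fun i => (b i : Fin N → B)) = (Submodule.subtype U) '' Set.range b := by
        ext x; simp
      rw [h, Submodule.span_image, b.span_eq, Submodule.map_top, Submodule.range_subtype]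
      exact hu
    clear hu
    induction hu' using Submodule.span_induction with
    | mem x hx => obtain ⟨i, rfl⟩ := hx; exact hw' i
    | zero => simp [form]
    | add x y _ _ hx hy => rw [form_add_left, hx, hy, add_zero]
    | smul c x _ hx => rw [form_smul_left, hx, mul_zero]
  rw [codisjoint_iff]
  apply Submodule.eq_top_of_finrank_eq
  have h1 := LinearMap.finrank_range_add_finrank_ker L
  have := finite_op_fun (B := B) (Module.finrank Bᵐᵒᵖ U)
  have h2 := Submodule.finrank_le (LinearMap.range L)
  rw [finrank_op_fun] at h1 h2
  have h3 := Submodule.finrank_mono hker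
  have h4 := Submodule.finrank_sup_add_finrank_inf_eq U (orth Q U)
  rw [disjoint_iff.1 hdisj, finrank_bot] at h4
  have h5 := Submodule.finrank_le (U ⊔ orth Q U)
  rw [finrank_op_fun] at h5 ⊢
  omega

end Forms

/-! ### The domains -/

section Domains

variable {W : Type} [AddCommGroup W] [Module ℂ W]

/-- The Hermitian form `h` is negative definite on `z`. -/
def NegDef (h : W → W → ℂ) (z : Submodule ℂ W) : Prop := ∀ v ∈ z, v ≠ 0 → (h v v).re < 0

/-- The negative index `s` of the signature `(r, s)` of the Hermitian form `h` on `U`: the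
largest dimension of a negative definite subspace. -/
def negIndex (h : W → W → ℂ) (U : Submodule ℂ W) : ℕ :=
  sSup {d | ∃ z ≤ U, NegDef h z ∧ Module.finrank ℂ z = d}

/-- The subspaces of `U` on which `h` is negative definite, of dimension the negative index
of `h` on `U`. -/
def unitaryDomain (h : W → W → ℂ) (U : Submodule ℂ W) : Set (Gr W) :=
  {z | z ≤ U ∧ NegDef h z ∧ Module.finrank ℂ z = negIndex h U}

/-- The subspaces of `U` of half the dimension of `U` that are isotropic for `S` and on which
`h` is negative definite. -/
def lagrangianDomain (h S : W → W → ℂ) (U : Submodule ℂ W) : Set (Gr W) :=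
  {z | z ≤ U ∧ (∀ v ∈ z, ∀ w ∈ z, S v w = 0) ∧ NegDef h z ∧
    2 * Module.finrank ℂ z = Module.finrank ℂ U}

/-- Additivity of a function of two variables. -/
def Biadditive (h : W → W → ℂ) : Prop :=
  (∀ u v w, h (u + v) w = h u w + h v w) ∧ ∀ u v w, h u (v + w) = h u v + h u w

theorem NegDef.sup {h : W → W → ℂ} (hadd : Biadditive h) {z' z : Submodule ℂ W}
    (h' : NegDef h z') (h0 : NegDef h z) (h1 : ∀ u ∈ z', ∀ v ∈ z, h u v = 0)
    (h2 : ∀ u ∈ z', ∀ v ∈ z, h v u = 0) : NegDef h (z' ⊔ z) := by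
  intro x hx hx0
  obtain ⟨u, hu, v, hv, rfl⟩ := Submodule.mem_sup.1 hx
  rw [hadd.1, hadd.2, hadd.2, h1 u hu v hv, h2 u hu v hv, add_zero, zero_add, Complex.add_re]
  have hz : (h 0 0).re = 0 := by
    have := hadd.1 0 0 0
    simp only [add_zero] at this
    have h3 : h 0 0 = 0 := by linear_combination -this
    rw [h3, Complex.zero_re]
  by_cases hu0 : u = 0
  · have hv0 : v ≠ 0 := by rintro rfl; exact hx0 (by rw [hu0, add_zero])
    have := h0 v hv hv0
    rw [hu0, hz]; linarith
  · have h4 := h' u hu hu0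
    by_cases hv0 : v = 0
    · rw [hv0, hz]; linarith
    · have := h0 v hv hv0
      linarith

theorem NegDef.disjoint {h : W → W → ℂ} {z' z : Submodule ℂ W}
    (h' : NegDef h z') (h1 : ∀ u ∈ z', ∀ v ∈ z, h u v = 0) : Disjoint z' z := by
  rw [Submodule.disjoint_def]
  intro x hx hx'
  by_contra hne
  have := h' x hx hne
  rw [h1 x hx x hx', Complex.zero_re] at this
  exact lt_irrefl _ this

theorem lagrangianDomain_sup [FiniteDimensional ℂ W] {h S : W → W → ℂ} (hadd : Biadditive h)
    (sadd : Biadditive S) {U U' : Submodule ℂ W} (hU : IsCompl U U')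
    (h1 : ∀ u ∈ U, ∀ v ∈ U', h u v = 0) (h2 : ∀ u ∈ U, ∀ v ∈ U', h v u = 0)
    (s1 : ∀ u ∈ U, ∀ v ∈ U', S u v = 0) (s2 : ∀ u ∈ U, ∀ v ∈ U', S v u = 0)
    {z' z : Gr W} (hz' : z' ∈ lagrangianDomain h S U) (hz : z ∈ lagrangianDomain h S U') :
    z' ⊔ z ∈ lagrangianDomain h S ⊤ := by
  obtain ⟨a1, a2, a3, a4⟩ := hz'
  obtain ⟨b1, b2, b3, b4⟩ := hz
  refine ⟨le_top, ?_, ?_, ?_⟩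
  · intro x hx y hy
    obtain ⟨u, hu, v, hv, rfl⟩ := Submodule.mem_sup.1 hx
    obtain ⟨u', hu', v', hv', rfl⟩ := Submodule.mem_sup.1 hy
    rw [sadd.1, sadd.2, sadd.2, a2 u hu u' hu', b2 v hv v' hv', s1 u (a1 hu) v' (b1 hv'),
      s2 u' (a1 hu') v (b1 hv)]
    simp
  · exact a3.sup hadd b3 (fun u hu v hv => h1 u (a1 hu) v (b1 hv))
      fun u hu v hv => h2 u (a1 hu) v (b1 hv)
  · have hd : Disjoint z' z := hU.disjoint.mono a1 b1
    have c1 := Submodule.finrank_sup_add_finrank_inf_eq z' z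
    rw [disjoint_iff.1 hd, finrank_bot] at c1
    have c2 := Submodule.finrank_add_eq_of_isCompl hU
    rw [finrank_top]
    omega

theorem finrank_le_negIndex [FiniteDimensional ℂ W] {h : W → W → ℂ} {U z : Submodule ℂ W}
    (hz : z ≤ U) (hn : NegDef h z) : Module.finrank ℂ z ≤ negIndex h U := by
  refine le_csSup ⟨Module.finrank ℂ W, ?_⟩ ⟨z, hz, hn, rfl⟩
  rintro d ⟨z, -, -, rfl⟩
  exact Submodule.finrank_le z

theorem negIndex_le {h : W → W → ℂ} {U : Submodule ℂ W} {n : ℕ}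
    (hn : ∀ z ≤ U, NegDef h z → Module.finrank ℂ z ≤ n) : negIndex h U ≤ n := by
  refine csSup_le ⟨0, ⊥, bot_le, ?_, finrank_bot ℂ W⟩ ?_
  · intro v hv hv0; exact absurd ((Submodule.mem_bot ℂ).1 hv) hv0
  · rintro d ⟨z, hz, hn', rfl⟩
    exact hn z hz hn'

end Domains

/-! ### Case A: `G = U(p, q)` -/

namespace CaseA

variable {N : ℕ}

/-- `U`, as a complex subspace of `V = ℂ ^ N`. -/
def cx (U : Submodule ℂᵐᵒᵖ (Fin N → ℂ)) : Submodule ℂ (Fin N → ℂ) where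
  carrier := U
  zero_mem' := U.zero_mem
  add_mem' := U.add_mem
  smul_mem' := by
    intro c x hx
    have : c • x = MulOpposite.op c • x := by ext i; simp [mul_comm]
    rw [SetLike.mem_coe, this]
    exact U.smul_mem _ hx

/-- The action of `GL_N(ℂ)` on `ℂ ^ N`. -/
def act : (Matrix (Fin N) (Fin N) ℂ)ˣ →* Module.End ℂ (Fin N → ℂ) where
  toFun g := Matrix.mulVecLin g.1
  map_one' := by simp; rfl
  map_mul' a b := by simp [Matrix.mulVecLin_mul]; rfl

/-- `D(U)`: the negative definite subspaces of `U` of dimension `s`, where `(r, s)` is the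
signature of the form on `U`. -/
def D (Q : Matrix (Fin N) (Fin N) ℂ) (U : Submodule ℂᵐᵒᵖ (Fin N → ℂ)) : Set (Gr (Fin N → ℂ)) :=
  unitaryDomain (form Q) (cx U)

theorem biadditive (Q : Matrix (Fin N) (Fin N) ℂ) : Biadditive (form Q) :=
  ⟨form_add_left Q, form_add_right Q⟩

theorem form_csmul_right (Q : Matrix (Fin N) (Fin N) ℂ) (v w : Fin N → ℂ) (c : ℂ) :
    form Q v (c • w) = c * form Q v w := by
  simp [form, Matrix.mulVec_smul, dotProduct_smul]

theorem form_csmul_left (Q : Matrix (Fin N) (Fin N) ℂ) (v w : Fin N → ℂ) (c : ℂ) :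
    form Q (c • v) w = star c * form Q v w := by
  simp [form, smul_dotProduct]

theorem sup_mem {Q : Matrix (Fin N) (Fin N) ℂ} (hQ : Qᴴ = Q) {U : Submodule ℂᵐᵒᵖ (Fin N → ℂ)}
    (hU : Nondeg Q U) {z' z : Gr (Fin N → ℂ)} (hz' : z' ∈ D Q U) (hz : z ∈ D Q (orth Q U)) :
    z' ⊔ z ∈ D Q ⊤ := by
  obtain ⟨a1, a2, a3⟩ := hz'
  obtain ⟨b1, b2, b3⟩ := hz
  have symm : ∀ {v w}, form Q v w = 0 → form Q w v = 0 := form_eq_zero_symm (Or.inl hQ)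
  have c1 : ∀ u ∈ cx U, ∀ v ∈ cx (orth Q U), form Q u v = 0 := fun u hu v hv => hv u hu
  have c2 : ∀ u ∈ cx U, ∀ v ∈ cx (orth Q U), form Q v u = 0 :=
    fun u hu v hv => symm (c1 u hu v hv)
  have hneg : NegDef (form Q) (z' ⊔ z) :=
    a2.sup (biadditive Q) b2 (fun u hu v hv => c1 u (a1 hu) v (b1 hv))
      fun u hu v hv => c2 u (a1 hu) v (b1 hv)
  have hdisj : Disjoint z' z := a2.disjoint fun u hu v hv => c1 u (a1 hu) v (b1 hv)
  -- the form is non-negative on the complement of a maximal negative definite subspace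
  have key : ∀ (T y : Submodule ℂ (Fin N → ℂ)), y ≤ T → NegDef (form Q) y →
      Module.finrank ℂ y = negIndex (form Q) T → ∀ u ∈ T, (∀ v ∈ y, form Q v u = 0) →
      0 ≤ (form Q u u).re := by
    intro T y hyT hy hdim u hu huy
    by_contra hlt
    push Not at hlt
    have hspan : NegDef (form Q) (Submodule.span ℂ {u}) := by
      intro x hx hx0
      obtain ⟨c, rfl⟩ := Submodule.mem_span_singleton.1 hx
      have hc : c ≠ 0 := by rintro rfl; exact hx0 (zero_smul _ _)
      rw [form_csmul_left, form_csmul_right, ← mul_assoc]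
      have : star c * c = ((Complex.normSq c : ℝ) : ℂ) := by
        rw [mul_comm]; exact Complex.mul_conj c
      rw [this, Complex.re_ofReal_mul]
      exact mul_neg_of_pos_of_neg (Complex.normSq_pos.2 hc) hlt
    have o1 : ∀ v ∈ y, ∀ x ∈ Submodule.span ℂ {u}, form Q v x = 0 := by
      intro v hv x hx
      obtain ⟨c, rfl⟩ := Submodule.mem_span_singleton.1 hx
      rw [form_csmul_right, huy v hv, mul_zero]
    have hn := hy.sup (biadditive Q) hspan o1 fun v hv x hx => symm (o1 v hv x hx)
    have hle := finrank_le_negIndex (h := form Q) (U := T)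
      (sup_le hyT ((Submodule.span_singleton_le_iff_mem u T).2 hu)) hn
    have hd := Submodule.finrank_sup_add_finrank_inf_eq y (Submodule.span ℂ {u})
    rw [disjoint_iff.1 (hy.disjoint o1), finrank_bot, finrank_span_singleton] at hd
    · omega
    · rintro rfl
      simp [form] at hlt
  let Z : Submodule ℂᵐᵒᵖ (Fin N → ℂ) :=
    { carrier := ((z' ⊔ z : Submodule ℂ (Fin N → ℂ)) : Set (Fin N → ℂ))
      zero_mem' := Submodule.zero_mem _
      add_mem' := Submodule.add_mem _
      smul_mem' := by
        intro c x hx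
        have : c • x = c.unop • x := by ext i; simp [mul_comm]
        rw [SetLike.mem_coe, this]
        exact Submodule.smul_mem _ _ hx }
  have hZ : Nondeg Q Z := by
    intro w hw hw'
    by_contra h0
    have := hneg w hw h0
    rw [hw' w hw] at this
    exact lt_irrefl _ this
  have hcZ := isCompl_orth hZ
  have hcU := isCompl_orth hU
  have hpos : ∀ x ∈ cx (orth Q Z), 0 ≤ (form Q x x).re := by
    intro x hx
    have hxt : x ∈ U ⊔ orth Q U := by rw [hcU.sup_eq_top]; trivial
    obtain ⟨u, hu, w, hw, rfl⟩ := Submodule.mem_sup.1 hxt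
    have hu' : ∀ v ∈ z', form Q v u = 0 := by
      intro v hv
      have h1 : form Q v (u + w) = 0 := hx v ((le_sup_left : z' ≤ z' ⊔ z) hv)
      rwa [form_add_right, c1 v (a1 hv) w hw, add_zero] at h1
    have hw' : ∀ v ∈ z, form Q v w = 0 := by
      intro v hv
      have h1 : form Q v (u + w) = 0 := hx v ((le_sup_right : z ≤ z' ⊔ z) hv)
      rwa [form_add_right, c2 u hu v (b1 hv), zero_add] at h1
    have p1 := key _ _ a1 a2 a3 u hu hu'
    have p2 := key _ _ b1 b2 b3 w hw hw'
    rw [form_add_left, form_add_right, form_add_right, c1 u hu w hw, c2 u hu w hw, add_zero,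
      zero_add, Complex.add_re]
    linarith
  refine ⟨fun x _ => Submodule.mem_top (R := ℂᵐᵒᵖ) (x := x), hneg, le_antisymm ?_ ?_⟩
  · exact finrank_le_negIndex (fun x _ => Submodule.mem_top (R := ℂᵐᵒᵖ) (x := x)) hneg
  · refine negIndex_le fun y _ hy => ?_
    have hsup : z' ⊔ z ⊔ cx (orth Q Z) = ⊤ := by
      rw [eq_top_iff]
      intro x _
      have hxt : x ∈ Z ⊔ orth Q Z := by rw [hcZ.sup_eq_top]; trivial
      obtain ⟨u, hu, w, hw, rfl⟩ := Submodule.mem_sup.1 hxt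
      exact Submodule.mem_sup.2 ⟨u, hu, w, hw, rfl⟩
    have e1 := Submodule.finrank_add_le_finrank_add_finrank (z' ⊔ z) (cx (orth Q Z))
    rw [hsup, finrank_top] at e1
    have hyd : Disjoint y (cx (orth Q Z)) := by
      rw [Submodule.disjoint_def]
      intro x hx hx'
      by_contra h0
      have := hy x hx h0
      have := hpos x hx'
      linarith
    have e2 := Submodule.finrank_sup_add_finrank_inf_eq y (cx (orth Q Z))
    rw [disjoint_iff.1 hyd, finrank_bot] at e2
    have e3 := Submodule.finrank_le (y ⊔ cx (orth Q Z))
    omega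

/-- The locally symmetric space `Γ \ D`. -/
abbrev M (Q : Matrix (Fin N) (Fin N) ℂ) (Γ : Subgroup (Matrix (Fin N) (Fin N) ℂ)ˣ) : Type :=
  LocSym act Γ (D Q ⊤)

/-- The locally symmetric space `Γ_U \ D_U`, where `D_U = D(U^⊥)`. -/
abbrev MU (Q : Matrix (Fin N) (Fin N) ℂ) (Γ : Subgroup (Matrix (Fin N) (Fin N) ℂ)ˣ)
    (U : Submodule ℂᵐᵒᵖ (Fin N → ℂ)) : Type :=
  LocSym act (stab Q Γ U) (D Q (orth Q U))

/-- The map `ρ_{U,z'} : Γ_U \ D_U → Γ \ D`, `z ↦ z' ⊕ z`. -/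
def rho {Q : Matrix (Fin N) (Fin N) ℂ} (hQ : Qᴴ = Q)
    (Γ : Subgroup (Matrix (Fin N) (Fin N) ℂ)ˣ) {U : Submodule ℂᵐᵒᵖ (Fin N → ℂ)}
    (hU : Nondeg Q U) (z' : D Q U) : C(MU Q Γ U, M Q Γ) :=
  sumMap act inf_le_left z'.1
    (fun _ hz => z'.2.2.1.disjoint fun u hu _ hv => hz.1 hv u (z'.2.1 hu))
    (fun _ hz => sup_mem hQ hU z'.2 hz)
    (fun g hg => by
      have hfix : ∀ v ∈ z'.1, act g v = v := fun v hv => stab_fix (Or.inl hQ) hg (z'.2.1 hv)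
      ext x
      constructor
      · rintro ⟨v, hv, rfl⟩
        rw [hfix v hv]; exact hv
      · exact fun hx => ⟨x, hx, hfix x hx⟩)

end CaseA

/-! ### Case B: `G = Sp(2n, ℝ)` -/

namespace CaseB

variable {N : ℕ}

/-- `U ⊗ ℂ`, as a complex subspace of `V ⊗ ℂ = ℂ ^ N`. -/
def cx (U : Submodule ℝᵐᵒᵖ (Fin N → ℝ)) : Submodule ℂ (Fin N → ℂ) where
  carrier := {v | (fun i => (v i).re) ∈ U ∧ (fun i => (v i).im) ∈ U}
  zero_mem' := ⟨U.zero_mem, U.zero_mem⟩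
  add_mem' := fun ha hb => ⟨U.add_mem ha.1 hb.1, U.add_mem ha.2 hb.2⟩
  smul_mem' := by
    intro c x hx
    have h1 : (fun i => ((c • x) i).re) = MulOpposite.op c.re • (fun i => (x i).re) +
        MulOpposite.op (-c.im) • (fun i => (x i).im) := by
      ext i; simp; ring
    have h2 : (fun i => ((c • x) i).im) = MulOpposite.op c.re • (fun i => (x i).im) +
        MulOpposite.op c.im • (fun i => (x i).re) := by
      ext i; simp [mul_comm]
    constructor
    · rw [h1]; exact U.add_mem (U.smul_mem _ hx.1) (U.smul_mem _ hx.2)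
    · rw [h2]; exact U.add_mem (U.smul_mem _ hx.2) (U.smul_mem _ hx.1)

/-- The action of `GL_N(ℝ)` on `V ⊗ ℂ = ℂ ^ N`. -/
def act : (Matrix (Fin N) (Fin N) ℝ)ˣ →* Module.End ℂ (Fin N → ℂ) where
  toFun g := Matrix.mulVecLin (g.1.map Complex.ofReal)
  map_one' := by
    have : ((1 : Matrix (Fin N) (Fin N) ℝ).map Complex.ofReal) = 1 :=
      Matrix.map_one _ Complex.ofReal_zero Complex.ofReal_one
    rw [Units.val_one, this]
    exact Matrix.mulVecLin_one
  map_mul' a b := by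
    have : (a.1 * b.1).map Complex.ofReal = a.1.map Complex.ofReal * b.1.map Complex.ofReal :=
      Matrix.map_mul (f := Complex.ofRealHom)
    rw [Units.val_mul, this]
    exact Matrix.mulVecLin_mul _ _

/-- The complex bilinear extension `S` of the form to `V ⊗ ℂ`. -/
def S (Q : Matrix (Fin N) (Fin N) ℝ) (v w : Fin N → ℂ) : ℂ := v ⬝ᵥ (Q.map Complex.ofReal *ᵥ w)

/-- The Hermitian form `i S(v̄, w)`. -/
def herm (Q : Matrix (Fin N) (Fin N) ℝ) (v w : Fin N → ℂ) : ℂ := Complex.I * S Q (star v) w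

/-- `D(U)`: the Lagrangian complex subspaces of `U ⊗ ℂ` on which `i S(v̄, w)` is negative
definite. -/
def D (Q : Matrix (Fin N) (Fin N) ℝ) (U : Submodule ℝᵐᵒᵖ (Fin N → ℝ)) : Set (Gr (Fin N → ℂ)) :=
  lagrangianDomain (herm Q) (S Q) (cx U)

theorem S_biadditive (Q : Matrix (Fin N) (Fin N) ℝ) : Biadditive (S Q) :=
  ⟨fun u v w => by simp [S, add_dotProduct],
    fun u v w => by simp [S, Matrix.mulVec_add, dotProduct_add]⟩

theorem herm_biadditive (Q : Matrix (Fin N) (Fin N) ℝ) : Biadditive (herm Q) :=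
  ⟨fun u v w => by simp [herm, (S_biadditive Q).1, mul_add],
    fun u v w => by simp [herm, (S_biadditive Q).2, mul_add]⟩

theorem S_eq (Q : Matrix (Fin N) (Fin N) ℝ) (v w : Fin N → ℂ) :
    S Q v w = ((form Q (fun i => (v i).re) (fun i => (w i).re) -
        form Q (fun i => (v i).im) (fun i => (w i).im) : ℝ) : ℂ) +
      ((form Q (fun i => (v i).re) (fun i => (w i).im) +
        form Q (fun i => (v i).im) (fun i => (w i).re) : ℝ) : ℂ) * Complex.I := by
  apply Complex.ext
  · simp [S, form, dotProduct, Matrix.mulVec, Finset.mul_sum, Complex.re_sum, Complex.im_sum,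
      Finset.sum_sub_distrib]
  · simp [S, form, dotProduct, Matrix.mulVec, Finset.mul_sum, Complex.re_sum, Complex.im_sum,
      Finset.sum_add_distrib]

theorem S_eq_zero {Q : Matrix (Fin N) (Fin N) ℝ} {U U' : Submodule ℝᵐᵒᵖ (Fin N → ℝ)}
    (h : ∀ u ∈ U, ∀ v ∈ U', form Q u v = 0) {u v : Fin N → ℂ} (hu : u ∈ cx U) (hv : v ∈ cx U') :
    S Q u v = 0 := by
  rw [S_eq, h _ hu.1 _ hv.1, h _ hu.1 _ hv.2, h _ hu.2 _ hv.1, h _ hu.2 _ hv.2]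
  simp

theorem star_mem {U : Submodule ℝᵐᵒᵖ (Fin N → ℝ)} {u : Fin N → ℂ} (hu : u ∈ cx U) :
    star u ∈ cx U := by
  refine ⟨hu.1, ?_⟩
  have : (fun i => (star u i).im) = -(fun i => (u i).im) := by ext i; simp
  rw [this]; exact U.neg_mem hu.2

theorem herm_eq_zero {Q : Matrix (Fin N) (Fin N) ℝ} {U U' : Submodule ℝᵐᵒᵖ (Fin N → ℝ)}
    (h : ∀ u ∈ U, ∀ v ∈ U', form Q u v = 0) {u v : Fin N → ℂ} (hu : u ∈ cx U) (hv : v ∈ cx U') :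
    herm Q u v = 0 := by
  rw [herm, S_eq_zero h (star_mem hu) hv, mul_zero]

theorem cx_isCompl {U U' : Submodule ℝᵐᵒᵖ (Fin N → ℝ)} (h : IsCompl U U') :
    IsCompl (cx U) (cx U') := by
  constructor
  · rw [Submodule.disjoint_def]
    intro x hx hx'
    have h1 := (Submodule.disjoint_def.1 h.disjoint) _ hx.1 hx'.1
    have h2 := (Submodule.disjoint_def.1 h.disjoint) _ hx.2 hx'.2
    ext i
    exact Complex.ext (congrFun h1 i) (congrFun h2 i)
  · rw [codisjoint_iff, eq_top_iff]
    intro x _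
    have hr : (fun i => (x i).re) ∈ U ⊔ U' := by rw [h.sup_eq_top]; trivial
    have hi : (fun i => (x i).im) ∈ U ⊔ U' := by rw [h.sup_eq_top]; trivial
    obtain ⟨a, ha, b, hb, hab⟩ := Submodule.mem_sup.1 hr
    obtain ⟨c, hc, d, hd, hcd⟩ := Submodule.mem_sup.1 hi
    refine Submodule.mem_sup.2 ⟨fun i => ⟨a i, c i⟩, ⟨ha, hc⟩, fun i => ⟨b i, d i⟩, ⟨hb, hd⟩, ?_⟩
    ext i
    exact Complex.ext (congrFun hab i) (congrFun hcd i)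

theorem cx_top : cx (⊤ : Submodule ℝᵐᵒᵖ (Fin N → ℝ)) = ⊤ :=
  eq_top_iff.2 fun _ _ => ⟨trivial, trivial⟩

theorem orth_zero {Q : Matrix (Fin N) (Fin N) ℝ} (hQ : Qᵀ = -Q)
    (U : Submodule ℝᵐᵒᵖ (Fin N → ℝ)) : ∀ u ∈ orth Q U, ∀ v ∈ U, form Q u v = 0 :=
  fun _ hu v hv => form_eq_zero_symm (Or.inr hQ) (hu v hv)

theorem sup_mem {Q : Matrix (Fin N) (Fin N) ℝ} (hQ : Qᵀ = -Q)
    {U : Submodule ℝᵐᵒᵖ (Fin N → ℝ)} (hU : Nondeg Q U) {z' z : Gr (Fin N → ℂ)}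
    (hz' : z' ∈ D Q U) (hz : z ∈ D Q (orth Q U)) : z' ⊔ z ∈ D Q ⊤ := by
  rw [D, cx_top]
  have h1 : ∀ u ∈ U, ∀ v ∈ orth Q U, form Q u v = 0 := fun u hu v hv => hv u hu
  exact lagrangianDomain_sup (herm_biadditive Q) (S_biadditive Q) (cx_isCompl (isCompl_orth hU))
    (fun _ hu _ hv => herm_eq_zero h1 hu hv) (fun _ hu _ hv => herm_eq_zero (orth_zero hQ U) hv hu)
    (fun _ hu _ hv => S_eq_zero h1 hu hv) (fun _ hu _ hv => S_eq_zero (orth_zero hQ U) hv hu)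
    hz' hz

theorem act_fix {Q : Matrix (Fin N) (Fin N) ℝ} (hQ : Qᵀ = -Q)
    {Γ : Subgroup (Matrix (Fin N) (Fin N) ℝ)ˣ} {U : Submodule ℝᵐᵒᵖ (Fin N → ℝ)}
    {g : (Matrix (Fin N) (Fin N) ℝ)ˣ} (hg : g ∈ stab Q Γ U) {v : Fin N → ℂ} (hv : v ∈ cx U) :
    act g v = v := by
  have h1 := stab_fix (Or.inr hQ) hg hv.1
  have h2 := stab_fix (Or.inr hQ) hg hv.2
  ext i
  have e1 := congrFun h1 i
  have e2 := congrFun h2 i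
  change ((g.1.map Complex.ofReal) *ᵥ v) i = v i
  simp only [Matrix.mulVec, dotProduct] at e1 e2 ⊢
  apply Complex.ext
  · simpa [Complex.re_sum] using e1
  · simpa [Complex.im_sum] using e2

/-- The locally symmetric space `Γ \ D`. -/
abbrev M (Q : Matrix (Fin N) (Fin N) ℝ) (Γ : Subgroup (Matrix (Fin N) (Fin N) ℝ)ˣ) : Type :=
  LocSym act Γ (D Q ⊤)

/-- The locally symmetric space `Γ_U \ D_U`, where `D_U = D(U^⊥)`. -/
abbrev MU (Q : Matrix (Fin N) (Fin N) ℝ) (Γ : Subgroup (Matrix (Fin N) (Fin N) ℝ)ˣ)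
    (U : Submodule ℝᵐᵒᵖ (Fin N → ℝ)) : Type :=
  LocSym act (stab Q Γ U) (D Q (orth Q U))

/-- The map `ρ_{U,z'} : Γ_U \ D_U → Γ \ D`, `z ↦ z' ⊕ z`. -/
def rho {Q : Matrix (Fin N) (Fin N) ℝ} (hQ : Qᵀ = -Q)
    (Γ : Subgroup (Matrix (Fin N) (Fin N) ℝ)ˣ) {U : Submodule ℝᵐᵒᵖ (Fin N → ℝ)}
    (hU : Nondeg Q U) (z' : D Q U) : C(MU Q Γ U, M Q Γ) :=
  sumMap act inf_le_left z'.1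
    (fun _ hz => z'.2.2.2.1.disjoint fun _ hu _ hv =>
      herm_eq_zero (U := U) (U' := orth Q U) (fun u hu v hv => hv u hu) (z'.2.1 hu) (hz.1 hv))
    (fun _ hz => sup_mem hQ hU z'.2 hz)
    (fun g hg => by
      have hfix : ∀ v ∈ z'.1, act g v = v := fun v hv => act_fix hQ hg (z'.2.1 hv)
      ext x
      constructor
      · rintro ⟨v, hv, rfl⟩
        rw [hfix v hv]; exact hv
      · exact fun hx => ⟨x, hx, hfix x hx⟩)

end CaseB

/-! ### Case C: `G = O*(2n)` -/

namespace CaseC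

variable {N : ℕ}

/-- `V = ℍ ^ N`, regarded below as a complex vector space through multiplication by `ℂ ⊆ ℍ` on
the right. -/
def HSpace (N : ℕ) : Type := Fin N → ℍ[ℝ]

instance : AddCommGroup (HSpace N) := inferInstanceAs (AddCommGroup (Fin N → ℍ[ℝ]))

instance : TopologicalSpace (HSpace N) := inferInstanceAs (TopologicalSpace (Fin N → ℍ[ℝ]))

instance : ContinuousAdd (HSpace N) := inferInstanceAs (ContinuousAdd (Fin N → ℍ[ℝ]))

/-- The embedding `a + b i ↦ a + b i` of `ℂ` into `ℍ`. -/
def toH (c : ℂ) : ℍ[ℝ] := Quaternion.ofComplex c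

instance : SMul ℂ (HSpace N) := ⟨fun c v i => v i * toH c⟩

theorem smul_apply (c : ℂ) (v : HSpace N) (i : Fin N) : (c • v) i = v i * toH c := rfl

theorem add_apply (v w : HSpace N) (i : Fin N) : (v + w) i = v i + w i := rfl

instance : Module ℂ (HSpace N) where
  one_smul v := by funext i; rw [smul_apply]; simp [toH]
  mul_smul a b v := by
    funext i; simp only [smul_apply]; rw [mul_assoc]; congr 1; simp [toH, mul_comm a b]
  smul_zero a := by funext i; rw [smul_apply]; exact zero_mul _
  smul_add a v w := by funext i; simp only [smul_apply, add_apply]; exact add_mul _ _ _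
  add_smul a b v := by
    funext i; simp only [smul_apply, add_apply]; rw [← mul_add]; congr 1; simp [toH]
  zero_smul v := by
    funext i; rw [smul_apply]
    have : toH 0 = 0 := by simp [toH]
    rw [this, mul_zero]; rfl

instance : ContinuousConstSMul ℂ (HSpace N) where
  continuous_const_smul c := by
    change Continuous fun (v : Fin N → ℍ[ℝ]) i => v i * toH c
    fun_prop

instance : FiniteDimensional ℂ (HSpace N) := by
  let : Module ℝ (HSpace N) := inferInstanceAs (Module ℝ (Fin N → ℍ[ℝ]))
  have : Module.Finite ℝ (HSpace N) := inferInstanceAs (Module.Finite ℝ (Fin N → ℍ[ℝ]))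
  have : IsScalarTower ℝ ℂ (HSpace N) := by
    refine ⟨fun r c v => ?_⟩
    funext i
    change v i * toH (r • c) = r • (v i * toH c)
    have : toH (r • c) = r • toH c := map_smul _ _ _
    rw [this, mul_smul_comm]
  exact Module.Finite.of_restrictScalars_finite ℝ ℂ (HSpace N)

/-- `U`, as a complex subspace of `V`. -/
def cx (U : Submodule ℍ[ℝ]ᵐᵒᵖ (Fin N → ℍ[ℝ])) : Submodule ℂ (HSpace N) where
  carrier := {v | (show Fin N → ℍ[ℝ] from v) ∈ U}
  zero_mem' := U.zero_mem
  add_mem' := U.add_mem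
  smul_mem' c _ hx := U.smul_mem (MulOpposite.op (toH c)) hx

/-- The action of `GL_N(ℍ)` on `V = ℍ ^ N`. -/
def act : (Matrix (Fin N) (Fin N) ℍ[ℝ])ˣ →* Module.End ℂ (HSpace N) where
  toFun g :=
    { toFun := fun v => (g.1 *ᵥ v : Fin N → ℍ[ℝ])
      map_add' := fun v w => Matrix.mulVec_add g.1 v w
      map_smul' := fun c v => Matrix.mulVec_smul g.1 (MulOpposite.op (toH c)) v }
  map_one' := LinearMap.ext fun v => Matrix.one_mulVec (α := ℍ[ℝ]) v
  map_mul' a b := LinearMap.ext fun v => (Matrix.mulVec_mulVec (α := ℍ[ℝ]) v a.1 b.1).symm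

/-- The skew-Hermitian form `H(v, w) = a + b i`, where `(v, w) = a + b i + c j + d k`. -/
def H (Q : Matrix (Fin N) (Fin N) ℍ[ℝ]) (v w : HSpace N) : ℂ :=
  ⟨(form Q v w).re, (form Q v w).imI⟩

/-- Right multiplication by `j`. -/
def mulJ (v : HSpace N) : HSpace N := fun i => v i * ⟨0, 0, 1, 0⟩

/-- The symmetric complex bilinear form `S(v, w) = H(v j, w)`. -/
def S (Q : Matrix (Fin N) (Fin N) ℍ[ℝ]) (v w : HSpace N) : ℂ := H Q (mulJ v) w

/-- The Hermitian form `i H(v, w)`. -/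
def herm (Q : Matrix (Fin N) (Fin N) ℍ[ℝ]) (v w : HSpace N) : ℂ := Complex.I * H Q v w

/-- `D(U)`: the complex subspaces of `U` that are Lagrangian for `S` and on which `i H` is
negative definite. -/
def D (Q : Matrix (Fin N) (Fin N) ℍ[ℝ]) (U : Submodule ℍ[ℝ]ᵐᵒᵖ (Fin N → ℍ[ℝ])) :
    Set (Gr (HSpace N)) :=
  lagrangianDomain (herm Q) (S Q) (cx U)

theorem H_biadditive (Q : Matrix (Fin N) (Fin N) ℍ[ℝ]) : Biadditive (H Q) := by
  constructor
  · intro u v w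
    have : form Q (u + v : HSpace N) w = form Q u w + form Q v w := form_add_left Q u v w
    apply Complex.ext <;> simp [H, this]
  · intro u v w
    have : form Q u (v + w : HSpace N) = form Q u v + form Q u w := form_add_right Q u v w
    apply Complex.ext <;> simp [H, this]

theorem mulJ_add (v w : HSpace N) : mulJ (v + w) = mulJ v + mulJ w := by
  funext i; exact add_mul _ _ _

theorem S_biadditive (Q : Matrix (Fin N) (Fin N) ℍ[ℝ]) : Biadditive (S Q) :=
  ⟨fun u v w => by simp only [S, mulJ_add, (H_biadditive Q).1],
    fun u v w => by simp only [S, (H_biadditive Q).2]⟩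

theorem herm_biadditive (Q : Matrix (Fin N) (Fin N) ℍ[ℝ]) : Biadditive (herm Q) :=
  ⟨fun u v w => by simp only [herm, (H_biadditive Q).1, mul_add],
    fun u v w => by simp only [herm, (H_biadditive Q).2, mul_add]⟩

theorem H_eq_zero {Q : Matrix (Fin N) (Fin N) ℍ[ℝ]} {u v : HSpace N} (h : form Q u v = 0) :
    H Q u v = 0 := by
  apply Complex.ext <;> simp [H, h]

theorem herm_eq_zero {Q : Matrix (Fin N) (Fin N) ℍ[ℝ]}
    {U U' : Submodule ℍ[ℝ]ᵐᵒᵖ (Fin N → ℍ[ℝ])} (h : ∀ u ∈ U, ∀ v ∈ U', form Q u v = 0)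
    {u v : HSpace N} (hu : u ∈ cx U) (hv : v ∈ cx U') : herm Q u v = 0 := by
  rw [herm, H_eq_zero (h u hu v hv), mul_zero]

theorem S_eq_zero {Q : Matrix (Fin N) (Fin N) ℍ[ℝ]}
    {U U' : Submodule ℍ[ℝ]ᵐᵒᵖ (Fin N → ℍ[ℝ])} (h : ∀ u ∈ U, ∀ v ∈ U', form Q u v = 0)
    {u v : HSpace N} (hu : u ∈ cx U) (hv : v ∈ cx U') : S Q u v = 0 :=
  H_eq_zero (h _ (U.smul_mem (MulOpposite.op ⟨0, 0, 1, 0⟩) hu) v hv)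

theorem cx_isCompl {U U' : Submodule ℍ[ℝ]ᵐᵒᵖ (Fin N → ℍ[ℝ])} (h : IsCompl U U') :
    IsCompl (cx U) (cx U') := by
  constructor
  · rw [Submodule.disjoint_def]
    intro x hx hx'
    exact (Submodule.disjoint_def.1 h.disjoint) _ hx hx'
  · rw [codisjoint_iff, eq_top_iff]
    intro x _
    have hr : (show Fin N → ℍ[ℝ] from x) ∈ U ⊔ U' := by rw [h.sup_eq_top]; trivial
    obtain ⟨a, ha, b, hb, hab⟩ := Submodule.mem_sup.1 hr
    exact Submodule.mem_sup.2 ⟨a, ha, b, hb, hab⟩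

theorem cx_top : cx (⊤ : Submodule ℍ[ℝ]ᵐᵒᵖ (Fin N → ℍ[ℝ])) = ⊤ :=
  eq_top_iff.2 fun x _ =>
    Submodule.mem_top (R := ℍ[ℝ]ᵐᵒᵖ) (M := Fin N → ℍ[ℝ]) (x := x)

theorem orth_zero {Q : Matrix (Fin N) (Fin N) ℍ[ℝ]} (hQ : Qᴴ = -Q)
    (U : Submodule ℍ[ℝ]ᵐᵒᵖ (Fin N → ℍ[ℝ])) : ∀ u ∈ orth Q U, ∀ v ∈ U, form Q u v = 0 :=
  fun _ hu v hv => form_eq_zero_symm (Or.inr hQ) (hu v hv)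

theorem sup_mem {Q : Matrix (Fin N) (Fin N) ℍ[ℝ]} (hQ : Qᴴ = -Q)
    {U : Submodule ℍ[ℝ]ᵐᵒᵖ (Fin N → ℍ[ℝ])} (hU : Nondeg Q U) {z' z : Gr (HSpace N)}
    (hz' : z' ∈ D Q U) (hz : z ∈ D Q (orth Q U)) : z' ⊔ z ∈ D Q ⊤ := by
  rw [D, cx_top]
  have h1 : ∀ u ∈ U, ∀ v ∈ orth Q U, form Q u v = 0 := fun u hu v hv => hv u hu
  exact lagrangianDomain_sup (herm_biadditive Q) (S_biadditive Q) (cx_isCompl (isCompl_orth hU))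
    (fun _ hu _ hv => herm_eq_zero h1 hu hv) (fun _ hu _ hv => herm_eq_zero (orth_zero hQ U) hv hu)
    (fun _ hu _ hv => S_eq_zero h1 hu hv) (fun _ hu _ hv => S_eq_zero (orth_zero hQ U) hv hu)
    hz' hz

/-- The locally symmetric space `Γ \ D`. -/
abbrev M (Q : Matrix (Fin N) (Fin N) ℍ[ℝ]) (Γ : Subgroup (Matrix (Fin N) (Fin N) ℍ[ℝ])ˣ) : Type :=
  LocSym act Γ (D Q ⊤)

/-- The locally symmetric space `Γ_U \ D_U`, where `D_U = D(U^⊥)`. -/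
abbrev MU (Q : Matrix (Fin N) (Fin N) ℍ[ℝ]) (Γ : Subgroup (Matrix (Fin N) (Fin N) ℍ[ℝ])ˣ)
    (U : Submodule ℍ[ℝ]ᵐᵒᵖ (Fin N → ℍ[ℝ])) : Type :=
  LocSym act (stab Q Γ U) (D Q (orth Q U))

/-- The map `ρ_{U,z'} : Γ_U \ D_U → Γ \ D`, `z ↦ z' ⊕ z`. -/
def rho {Q : Matrix (Fin N) (Fin N) ℍ[ℝ]} (hQ : Qᴴ = -Q)
    (Γ : Subgroup (Matrix (Fin N) (Fin N) ℍ[ℝ])ˣ) {U : Submodule ℍ[ℝ]ᵐᵒᵖ (Fin N → ℍ[ℝ])}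
    (hU : Nondeg Q U) (z' : D Q U) : C(MU Q Γ U, M Q Γ) :=
  sumMap act inf_le_left z'.1
    (fun _ hz => z'.2.2.2.1.disjoint fun _ hu _ hv =>
      herm_eq_zero (U := U) (U' := orth Q U) (fun u hu v hv => hv u hu) (z'.2.1 hu) (hz.1 hv))
    (fun _ hz => sup_mem hQ hU z'.2 hz)
    (fun g hg => by
      have hfix : ∀ v ∈ z'.1, act g v = v := fun v hv => stab_fix (Or.inr hQ) hg (z'.2.1 hv)
      ext x
      constructor
      · rintro ⟨v, hv, rfl⟩
        rw [hfix v hv]; exact hv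
      · exact fun hx => ⟨x, hx, hfix x hx⟩)

end CaseC

/-! ### Homology classes -/

section Homology

/-- Singular homology `H_n(X; A)`. -/
abbrev Hn (A : ModuleCat.{0} ℤ) (n : ℕ) (X : Type) [TopologicalSpace X] : ModuleCat.{0} ℤ :=
  ((AlgebraicTopology.singularHomologyFunctor (ModuleCat.{0} ℤ) n).obj A).obj (TopCat.of X)

/-- The map induced by a continuous map on singular homology. -/
abbrev Hn.map (A : ModuleCat.{0} ℤ) (n : ℕ) {X Y : Type} [TopologicalSpace X]
    [TopologicalSpace Y] (f : C(X, Y)) : Hn A n X ⟶ Hn A n Y :=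
  ((AlgebraicTopology.singularHomologyFunctor (ModuleCat.{0} ℤ) n).obj A).map (TopCat.ofHom f)

/-- The inclusion of singular chain complexes `C_•(X ∖ {x}; ℤ) ⟶ C_•(X; ℤ)`. -/
abbrev puncturedChains (X : Type) [TopologicalSpace X] (x : X) :=
  ((AlgebraicTopology.singularChainComplexFunctor (ModuleCat.{0} ℤ)).obj (ModuleCat.of ℤ ℤ)).map
    (TopCat.ofHom (⟨Subtype.val, continuous_subtype_val⟩ : C({y : X // y ≠ x}, X)))

/-- The local homology `H_n(X, X ∖ {x}; ℤ)`: the homology of the relative singular chains. -/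
abbrev localHomology (n : ℕ) (X : Type) [TopologicalSpace X] (x : X) : ModuleCat.{0} ℤ :=
  (Limits.cokernel (puncturedChains X x)).homology n

/-- The restriction `H_n(X; ℤ) ⟶ H_n(X, X ∖ {x}; ℤ)`. -/
abbrev toLocalHomology (n : ℕ) (X : Type) [TopologicalSpace X] (x : X) :
    Hn (ModuleCat.of ℤ ℤ) n X ⟶ localHomology n X x :=
  HomologicalComplex.homologyMap (Limits.cokernel.π (puncturedChains X x)) n

/-- `μ ∈ H_n(X; ℤ)` is a fundamental class of the closed oriented `n`-manifold `X` (for some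
orientation): at every point `x` it restricts to a generator of the infinite cyclic group
`H_n(X, X ∖ {x}; ℤ)`. -/
def IsFundamentalClass (n : ℕ) (X : Type) [TopologicalSpace X]
    (μ : Hn (ModuleCat.of ℤ ℤ) n X) : Prop :=
  ∀ x : X, Function.Bijective fun k : ℤ => k • (toLocalHomology n X x).hom μ

/-- The homology class in `Y` of the cycle `f : X → Y`, where `X` carries the fundamental
class `μ`. -/
def cycleClass {n : ℕ} {X Y : Type} [TopologicalSpace X] [TopologicalSpace Y]
    (f : C(X, Y)) (μ : Hn (ModuleCat.of ℤ ℤ) n X) : Hn (ModuleCat.of ℤ ℤ) n Y :=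
  (Hn.map (ModuleCat.of ℤ ℤ) n f).hom μ

end Homology

end

end SpecialCycle

/-!
The maps `ρ_{U,z'}` and `ρ_{U,z''}` are homotopic, because `z'` and `z''` can be joined by a path in
`D(U)`; homotopic maps agree on singular homology. The work is in producing the path and in the
continuity of the resulting homotopy.

*The path.* Given `z₀, z₁ ∈ D(U)`, there is a complex subspace `p` of `U` (of `U ⊗ ℂ` in the
symplectic case) orthogonal to `z₀` on which the Hermitian form is non-negative and such that `z₁ ≤
z₀ ⊕ p`: the orthogonal complement of `z₀` when `G = U(p, q)`, the complex conjugate of `z₀` when `G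
= Sp(N, ℝ)`, and `z₀ j` when `G = O*(2N)`. Then `z₁` is the graph of a linear map `T : z₀ → p`, and
the graphs of `t T` for `0 ≤ t ≤ 1` stay negative definite, since shrinking the component in `p`
only lowers the value of the form. In the last two cases `z₀` and `p` are both isotropic for `S`, so
that isotropy of the graph of `T` passes to the graph of `t T`. See `joinedByFrames_of_orthogonal`
and `lagrangianDomain_joinedByFrames`. The path is constructed together with a lift to frames,
namely `u_i + t v_i` for a basis `u_i + v_i` of `z₁` with `u_i ∈ z₀` and `v_i ∈ p`.

*The homotopy.* The Grassmannian is a quotient of the space of frames, and concatenation of frames is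
continuous. Since the unit interval is locally compact, its product with the quotient map from
frames to `Γ_U \ D_U` is again a quotient map, so `(t, z) ↦ z_t ⊕ z` is continuous on
`[0, 1] × Γ_U \ D_U` (`Hn_map_sumMap_eq`).
-/

namespace SpecialCycle

noncomputable section

/-! ### Paths of frames and homotopies between the maps `z ↦ z' ⊕ z` -/

section Homotopy

variable {W : Type} [AddCommGroup W] [Module ℂ W]

theorem linearIndependent_append {m d : ℕ} {b : Fin m → W} {v : Fin d → W}
    (hb : LinearIndependent ℂ b) (hv : LinearIndependent ℂ v)
    (h : Disjoint (Submodule.span ℂ (Set.range b)) (Submodule.span ℂ (Set.range v))) :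
    LinearIndependent ℂ (Fin.append b v) := by
  have : Fin.append b v = Sum.elim b v ∘ finSumFinEquiv.symm := by
    rw [Equiv.eq_comp_symm]
    exact Fin.append_comp_sumElim
  rw [this]
  exact (hb.sum_type hv h).comp _ finSumFinEquiv.symm.injective

theorem span_range_append {m d : ℕ} (b : Fin m → W) (v : Fin d → W) :
    Submodule.span ℂ (Set.range (Fin.append b v)) =
      Submodule.span ℂ (Set.range b) ⊔ Submodule.span ℂ (Set.range v) := by
  rw [← Submodule.span_union]
  congr 1
  ext x
  simp only [Set.mem_range, Set.mem_union]
  constructor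
  · rintro ⟨i, rfl⟩
    refine Fin.addCases (fun j => ?_) (fun j => ?_) i
    · exact Or.inl ⟨j, by simp⟩
    · exact Or.inr ⟨j, by simp⟩
  · rintro (⟨i, rfl⟩ | ⟨i, rfl⟩)
    · exact ⟨Fin.castAdd _ i, by simp⟩
    · exact ⟨Fin.natAdd _ i, by simp⟩

variable [TopologicalSpace W]

/-- The subspaces `z₀` and `z₁` are joined within the set `E` of subspaces by a path that lifts to
a continuous path of frames. -/
def JoinedByFrames (E : Set (Gr W)) (z₀ z₁ : Gr W) : Prop :=
  ∃ (m : ℕ) (b : unitInterval → Fin m → W), Continuous b ∧ (∀ t, LinearIndependent ℂ (b t)) ∧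
    (∀ t, Submodule.span ℂ (Set.range (b t)) ∈ E) ∧
    Submodule.span ℂ (Set.range (b 0)) = z₀ ∧ Submodule.span ℂ (Set.range (b 1)) = z₁

/-- Along a continuous path of frames `b`, the subspace `⟨b t⟩ ⊕ ⟨f⟩` depends continuously on `t`
and on the frame `f`. -/
theorem continuous_span_sup_frameSpan {T : Type} [TopologicalSpace T] {m : ℕ} {b : T → Fin m → W}
    (hb : Continuous b) (hbi : ∀ t, LinearIndependent ℂ (b t)) (D : Set (Gr W))
    (hD : ∀ t, ∀ z ∈ D, Disjoint (Submodule.span ℂ (Set.range (b t))) z) :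
    Continuous fun p : T × (frameSpan ⁻¹' D : Set (Frame W)) =>
      (Submodule.span ℂ (Set.range (b p.1)) ⊔ frameSpan p.2.1 : Gr W) := by
  let Φ : T × (frameSpan ⁻¹' D : Set (Frame W)) → Frame W := fun p =>
    ⟨m + p.2.1.1, Fin.append (b p.1) p.2.1.2.1,
      linearIndependent_append (hbi p.1) p.2.1.2.2 (hD _ _ p.2.2)⟩
  have hΦ : Continuous Φ := by
    rw [continuous_iff_continuousAt]
    rintro ⟨t, ⟨d, v⟩, hv⟩
    -- on the open part where the second frame has length `d`, the map `Φ` is polynomial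
    let P : Set {v : Fin d → W // LinearIndependent ℂ v} :=
      (fun u => (⟨d, u⟩ : Frame W)) ⁻¹' (frameSpan ⁻¹' D)
    let ι : P → (frameSpan ⁻¹' D : Set (Frame W)) := fun u => ⟨⟨d, u.1⟩, u.2⟩
    have hι : Topology.IsOpenEmbedding ι :=
      (Topology.IsOpenEmbedding.sigmaMk
        (σ := fun d => {v : Fin d → W // LinearIndependent ℂ v}) (i := d)).restrictPreimage
        (frameSpan ⁻¹' D : Set (Frame W))
    have hι' : Topology.IsOpenEmbedding (Prod.map (id : T → T) ι) :=
      Topology.IsOpenEmbedding.id.prodMap hι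
    have hc : Continuous (Φ ∘ Prod.map (id : T → T) ι) := by
      change Continuous fun u : T × P => (⟨m + d, Fin.append (b u.1) u.2.1.1,
        linearIndependent_append (hbi u.1) u.2.1.2 (hD _ _ u.2.2)⟩ : Frame W)
      refine continuous_sigmaMk.comp (Continuous.subtype_mk ?_ _)
      refine continuous_pi fun i => ?_
      refine Fin.addCases (fun j => ?_) (fun j => ?_) i
      · simp only [Fin.append_left]
        exact (continuous_apply j).comp (hb.comp continuous_fst)
      · simp only [Fin.append_right]
        exact (continuous_apply j).comp
          (continuous_subtype_val.comp (continuous_subtype_val.comp continuous_snd))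
    exact (hι'.continuousAt_iff (x := (t, ⟨v, hv⟩))).1 hc.continuousAt
  have : (fun p : T × (frameSpan ⁻¹' D : Set (Frame W)) =>
      (Submodule.span ℂ (Set.range (b p.1)) ⊔ frameSpan p.2.1 : Gr W)) = frameSpan ∘ Φ :=
    funext fun p => (span_range_append (b p.1) p.2.1.2.1).symm
  rw [this]
  exact continuous_coinduced_rng.comp hΦ

/-- A path of frames from `z₀` to `z₁` gives a homotopy between the maps `z ↦ z₀ ⊕ z` and
`z ↦ z₁ ⊕ z` of the quotients, so that these agree on homology. -/
theorem Hn_map_sumMap_eq [FiniteDimensional ℂ W] [ContinuousAdd W] [ContinuousConstSMul ℂ W]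
    {𝒢 : Type} [Group 𝒢] (act : 𝒢 →* Module.End ℂ W) {Γ' Γ : Subgroup 𝒢} (hΓ : Γ' ≤ Γ)
    {D' D E : Set (Gr W)} (hdisj : ∀ z' ∈ E, ∀ z ∈ D', Disjoint z' z)
    (hmem : ∀ z' ∈ E, ∀ z ∈ D', (z' ⊔ z) ∈ D)
    (hfix : ∀ z' ∈ E, ∀ g ∈ Γ', Submodule.map (act g) z' = z')
    {z₀ z₁ : Gr W} (h₀ : z₀ ∈ E) (h₁ : z₁ ∈ E) (hj : JoinedByFrames E z₀ z₁)
    (A : ModuleCat.{0} ℤ) (n : ℕ) :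
    Hn.map A n (sumMap act hΓ z₀ (hdisj z₀ h₀) (hmem z₀ h₀) (hfix z₀ h₀)) =
      Hn.map A n (sumMap act hΓ z₁ (hdisj z₁ h₁) (hmem z₁ h₁) (hfix z₁ h₁)) := by
  obtain ⟨m, b, hb, hbi, hbE, rfl, rfl⟩ := hj
  let F : unitInterval × LocSym act Γ' D' → LocSym act Γ D := fun p =>
    sumMap act hΓ (Submodule.span ℂ (Set.range (b p.1))) (hdisj _ (hbE p.1)) (hmem _ (hbE p.1))
      (hfix _ (hbE p.1)) p.2
  let π : (frameSpan ⁻¹' D' : Set (Frame W)) → LocSym act Γ' D' :=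
    Quotient.mk (orbitSetoid act Γ' D') ∘ D'.restrictPreimage (frameSpan : Frame W → Gr W)
  have hπ : Topology.IsQuotientMap π :=
    isQuotientMap_quotient_mk'.comp
      (frameSpan_isOpenQuotientMap.restrictPreimage D').isQuotientMap
  -- the interval is locally compact, so continuity may be tested on frames
  have hF : Continuous F := by
    refine hπ.continuous_lift_prod_right ?_
    have hc := continuous_span_sup_frameSpan hb hbi D' fun t => hdisj _ (hbE t)
    exact continuous_quotient_mk'.comp (hc.subtype_mk fun p => hmem _ (hbE p.1) _ p.2.2)
  let H : ContinuousMap.Homotopy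
      (sumMap act hΓ _ (hdisj _ h₀) (hmem _ h₀) (hfix _ h₀) : C(LocSym act Γ' D', LocSym act Γ D))
      (sumMap act hΓ _ (hdisj _ h₁) (hmem _ h₁) (hfix _ h₁)) :=
    { toFun := F
      continuous_toFun := hF
      map_zero_left := fun _ => rfl
      map_one_left := fun _ => rfl }
  exact TopCat.Homotopy.congr_homologyMap_singularChainComplexFunctor
    (f := TopCat.ofHom _) (g := TopCat.ofHom _) H A n

end Homotopy

/-! ### Segments of negative definite subspaces -/

section Segment

variable {W : Type} [AddCommGroup W] [Module ℂ W]

/-- Homogeneity of a function of two variables for real scalars. -/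
def RealHomogeneous (h : W → W → ℂ) : Prop :=
  (∀ (t : ℝ) (v w : W), h ((t : ℂ) • v) w = t * h v w) ∧
    ∀ (t : ℝ) (v w : W), h v ((t : ℂ) • w) = t * h v w

/-- Shrinking the non-negative part `v` of a negative vector `u + v` leaves it negative. -/
theorem re_add_smul_neg {h : W → W → ℂ} (hadd : Biadditive h) (hhom : RealHomogeneous h)
    {u v : W} (huv : h u v = 0) (hvu : h v u = 0) (hv : 0 ≤ (h v v).re)
    (hneg : (h (u + v) (u + v)).re < 0) {t : ℝ} (ht : t ∈ Set.Icc (0 : ℝ) 1) :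
    (h (u + (t : ℂ) • v) (u + (t : ℂ) • v)).re < 0 := by
  have h1 : h (u + v) (u + v) = h u u + h v v := by
    rw [hadd.1, hadd.2, hadd.2, huv, hvu]; ring
  have h2 : h (u + (t : ℂ) • v) (u + (t : ℂ) • v) = h u u + ((t * t : ℝ) : ℂ) * h v v := by
    rw [hadd.1, hadd.2, hadd.2, hhom.1, hhom.1, hhom.2, hhom.2, huv, hvu]
    push_cast; ring
  rw [h1, Complex.add_re] at hneg
  rw [h2, Complex.add_re, Complex.re_ofReal_mul]
  have h3 : t * t ≤ 1 := mul_le_one₀ ht.2 ht.1 ht.2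
  have h4 := mul_le_mul_of_nonneg_right h3 hv
  linarith

variable [TopologicalSpace W]

/-- Let `h` be non-negative on `p`, and `p` orthogonal to `z₀`. A negative definite `z₁ ≤ z₀ ⊕ p` of
the dimension of `z₀` is the graph of a map `T` from `z₀` to `p`, and the graphs of `t T` for `0 ≤ t
≤ 1` join `z₀` to `z₁`. -/
theorem joinedByFrames_of_orthogonal [FiniteDimensional ℂ W] [ContinuousAdd W]
    (hcont : ∀ v : W, Continuous fun t : ℝ => (t : ℂ) • v)
    {h : W → W → ℂ} (hadd : Biadditive h) (hhom : RealHomogeneous h) {E : Set (Gr W)}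
    {z₀ z₁ p : Submodule ℂ W} (n₁ : NegDef h z₁)
    (hdim : Module.finrank ℂ z₁ = Module.finrank ℂ z₀) (hp : ∀ v ∈ p, 0 ≤ (h v v).re)
    (o₁ : ∀ u ∈ z₀, ∀ v ∈ p, h u v = 0) (o₂ : ∀ u ∈ z₀, ∀ v ∈ p, h v u = 0) (hsup : z₁ ≤ z₀ ⊔ p)
    (hE : ∀ (z : Submodule ℂ W) (t : ℝ), Module.finrank ℂ z = Module.finrank ℂ z₀ → NegDef h z →
      (∀ x ∈ z, ∃ u ∈ z₀, ∃ v ∈ p, u + v ∈ z₁ ∧ u + (t : ℂ) • v = x) → z ∈ E) :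
    JoinedByFrames E z₀ z₁ := by
  let w := Module.finBasis ℂ z₁
  have hsplit : ∀ i, ∃ u ∈ z₀, ∃ v ∈ p, u + v = (w i : W) := fun i =>
    Submodule.mem_sup.1 (hsup (w i).2)
  choose u hu v hv huv using hsplit
  have hwi : LinearIndependent ℂ fun i => (w i : W) :=
    w.linearIndependent.map' (Submodule.subtype z₁) (Submodule.ker_subtype _)
  let b : ℝ → Fin (Module.finrank ℂ z₁) → W := fun t i => u i + (t : ℂ) • v i
  have hsum : ∀ (t : ℝ) (c : Fin (Module.finrank ℂ z₁) → ℂ),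
      ∑ i, c i • b t i = ∑ i, c i • u i + (t : ℂ) • ∑ i, c i • v i := by
    intro t c
    simp only [b, smul_add, Finset.sum_add_distrib, Finset.smul_sum]
    congr 1
    exact Finset.sum_congr rfl fun i _ => smul_comm _ _ _
  have hmu : ∀ c : Fin (Module.finrank ℂ z₁) → ℂ, ∑ i, c i • u i ∈ z₀ := fun c =>
    Submodule.sum_mem _ fun i _ => Submodule.smul_mem _ _ (hu i)
  have hmv : ∀ c : Fin (Module.finrank ℂ z₁) → ℂ, ∑ i, c i • v i ∈ p := fun c =>
    Submodule.sum_mem _ fun i _ => Submodule.smul_mem _ _ (hv i)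
  have hw : ∀ c : Fin (Module.finrank ℂ z₁) → ℂ,
      ∑ i, c i • u i + ∑ i, c i • v i = ∑ i, c i • (w i : W) := by
    intro c
    simp only [← huv, smul_add, Finset.sum_add_distrib]
  have hmw : ∀ c : Fin (Module.finrank ℂ z₁) → ℂ, ∑ i, c i • u i + ∑ i, c i • v i ∈ z₁ :=
    fun c => hw c ▸ Submodule.sum_mem _ fun i _ => Submodule.smul_mem _ _ (w i).2
  have hneg : ∀ t ∈ Set.Icc (0 : ℝ) 1, ∀ c : Fin (Module.finrank ℂ z₁) → ℂ, c ≠ 0 →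
      (h (∑ i, c i • b t i) (∑ i, c i • b t i)).re < 0 := by
    intro t ht c hc
    rw [hsum]
    refine re_add_smul_neg hadd hhom (o₁ _ (hmu c) _ (hmv c)) (o₂ _ (hmu c) _ (hmv c))
      (hp _ (hmv c)) (n₁ _ (hmw c) fun h0 => hc ?_) ht
    rw [hw] at h0
    exact funext (Fintype.linearIndependent_iff.1 hwi c h0)
  have h00 : (h 0 0).re = 0 := by
    have := hhom.1 0 0 0
    simp only [Complex.ofReal_zero, zero_smul, zero_mul] at this
    rw [this, Complex.zero_re]
  have hbi : ∀ t ∈ Set.Icc (0 : ℝ) 1, LinearIndependent ℂ (b t) := by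
    intro t ht
    rw [Fintype.linearIndependent_iff]
    intro c hc
    by_contra! hne
    obtain ⟨i, hi⟩ := hne
    have := hneg t ht c fun h0 => hi (congrFun h0 i)
    rw [hc, h00] at this
    exact lt_irrefl _ this
  have hrank : ∀ t ∈ Set.Icc (0 : ℝ) 1,
      Module.finrank ℂ (Submodule.span ℂ (Set.range (b t))) = Module.finrank ℂ z₁ := by
    intro t ht
    simpa using finrank_span_eq_card (hbi t ht)
  refine ⟨_, fun t => b t, ?_, fun t => hbi t t.2, fun t => ?_, ?_, ?_⟩
  · exact continuous_pi fun i =>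
      continuous_const.add ((hcont (v i)).comp continuous_subtype_val)
  · refine hE _ t ((hrank t t.2).trans hdim) ?_ ?_
    · intro x hx hx0
      obtain ⟨c, rfl⟩ := (Submodule.mem_span_range_iff_exists_fun ℂ).1 hx
      refine hneg t t.2 c ?_
      rintro rfl
      exact hx0 (by simp)
    · intro x hx
      obtain ⟨c, rfl⟩ := (Submodule.mem_span_range_iff_exists_fun ℂ).1 hx
      exact ⟨_, hmu c, _, hmv c, hmw c, (hsum t c).symm⟩
  · have h0 : (0 : ℝ) ∈ Set.Icc (0 : ℝ) 1 := ⟨le_rfl, zero_le_one⟩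
    refine Submodule.eq_of_le_of_finrank_eq ?_ ((hrank 0 h0).trans hdim)
    rw [Submodule.span_le]
    rintro _ ⟨i, rfl⟩
    simpa [b] using hu i
  · have h1 : (1 : ℝ) ∈ Set.Icc (0 : ℝ) 1 := ⟨zero_le_one, le_rfl⟩
    refine Submodule.eq_of_le_of_finrank_eq ?_ (hrank 1 h1)
    rw [Submodule.span_le]
    rintro _ ⟨i, rfl⟩
    simp [b, huv]

/-- The Lagrangian domain is connected by segments as soon as there is a conjugation `τ` that
reverses the sign of `h` and carries an isotropic subspace for `S` to an isotropic subspace that is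
`h`-orthogonal to it: then `U = z₀ ⊕ τ z₀` for every point `z₀` of the domain. -/
theorem lagrangianDomain_joinedByFrames [FiniteDimensional ℂ W] [ContinuousAdd W]
    (hcont : ∀ v : W, Continuous fun t : ℝ => (t : ℂ) • v)
    {h S : W → W → ℂ} (hadd : Biadditive h) (hhom : RealHomogeneous h) (sadd : Biadditive S)
    (shom : RealHomogeneous S) (τ : W →ₛₗ[starRingEnd ℂ] W) (hτ : Function.Injective τ)
    (hneg : ∀ v, (h (τ v) (τ v)).re = -(h v v).re)
    (hS : ∀ v w, S v w = 0 → S (τ v) (τ w) = 0)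
    (h₁ : ∀ v w, S v w = 0 → S w v = 0 → h v (τ w) = 0)
    (h₂ : ∀ v w, S v w = 0 → S w v = 0 → h (τ w) v = 0)
    {U : Submodule ℂ W} (hU : ∀ v ∈ U, τ v ∈ U) {z₀ z₁ : Gr W}
    (hz₀ : z₀ ∈ lagrangianDomain h S U) (hz₁ : z₁ ∈ lagrangianDomain h S U) :
    JoinedByFrames (lagrangianDomain h S U) z₀ z₁ := by
  obtain ⟨a1, a2, a3, a4⟩ := hz₀
  obtain ⟨b1, b2, b3, b4⟩ := hz₁
  let p : Submodule ℂ W := Submodule.map τ z₀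
  have hpU : p ≤ U := by
    rintro _ ⟨v, hv, rfl⟩
    exact hU v (a1 hv)
  have o₁ : ∀ u ∈ z₀, ∀ v ∈ p, h u v = 0 := by
    rintro u hu _ ⟨v, hv, rfl⟩
    exact h₁ u v (a2 u hu v hv) (a2 v hv u hu)
  have o₂ : ∀ u ∈ z₀, ∀ v ∈ p, h v u = 0 := by
    rintro u hu _ ⟨v, hv, rfl⟩
    exact h₂ u v (a2 u hu v hv) (a2 v hv u hu)
  have hp : ∀ v ∈ p, 0 ≤ (h v v).re := by
    rintro _ ⟨v, hv, rfl⟩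
    rw [hneg]
    by_cases h0 : v = 0
    · have h00 := hhom.1 0 0 0
      simp only [Complex.ofReal_zero, zero_smul, zero_mul] at h00
      rw [h0, h00]; simp
    · linarith [a3 v hv h0]
  have hprank : Module.finrank ℂ z₀ ≤ Module.finrank ℂ p := by
    let c := Module.finBasis ℂ z₀
    have hc : LinearIndependent ℂ fun i => (c i : W) :=
      c.linearIndependent.map' (Submodule.subtype z₀) (Submodule.ker_subtype _)
    have hτc : LinearIndependent ℂ fun i => τ (c i : W) :=
      hc.map_of_surjective_injective (starRingEnd ℂ) τ.toAddMonoidHom star_involutive.surjective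
        (fun m hm => hτ (hm.trans (map_zero τ).symm)) fun r m => τ.map_smulₛₗ r m
    have hle : Submodule.span ℂ (Set.range fun i => τ (c i : W)) ≤ p := by
      rw [Submodule.span_le]
      rintro _ ⟨i, rfl⟩
      exact ⟨_, (c i).2, rfl⟩
    have h3 := Submodule.finrank_mono hle
    rw [finrank_span_eq_card hτc] at h3
    simpa using h3
  have hsup : z₀ ⊔ p = U := by
    refine Submodule.eq_of_le_of_finrank_le (sup_le a1 hpU) ?_
    have h1 := Submodule.finrank_sup_add_finrank_inf_eq z₀ p
    rw [disjoint_iff.1 (a3.disjoint o₁), finrank_bot] at h1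
    omega
  refine joinedByFrames_of_orthogonal hcont hadd hhom b3 (by omega) hp o₁ o₂ (hsup ▸ b1) ?_
  intro z t hdim hz hzx
  refine ⟨?_, ?_, hz, by omega⟩
  · intro x hx
    obtain ⟨u, hu, v, hv, -, rfl⟩ := hzx x hx
    exact U.add_mem (a1 hu) (U.smul_mem _ (hpU hv))
  · intro x hx y hy
    obtain ⟨u, hu, v, hv, huv, rfl⟩ := hzx x hx
    obtain ⟨u', hu', v', hv', huv', rfl⟩ := hzx y hy
    have hvv : S v v' = 0 := by
      obtain ⟨a, ha, rfl⟩ := hv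
      obtain ⟨a', ha', rfl⟩ := hv'
      exact hS _ _ (a2 _ ha _ ha')
    -- as `z₀` and `τ z₀` are isotropic, `S` is linear in `t` along the segment
    have h1 := b2 _ huv _ huv'
    rw [sadd.1, sadd.2, sadd.2, a2 u hu u' hu', hvv] at h1
    rw [sadd.1, sadd.2, sadd.2, shom.1, shom.2, shom.1, shom.2, a2 u hu u' hu', hvv]
    linear_combination (t : ℂ) * h1

end Segment

theorem map_eq_self_of_fixed {W : Type} [AddCommGroup W] [Module ℂ W] {f : Module.End ℂ W}
    {z : Submodule ℂ W} (hf : ∀ v ∈ z, f v = v) : Submodule.map f z = z := by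
  ext x
  constructor
  · rintro ⟨v, hv, rfl⟩
    rwa [hf v hv]
  · exact fun hx => ⟨x, hx, hf x hx⟩

/-! ### Case A: the segment in `z₀ ⊕ z₀^⊥` -/

namespace CaseA

variable {N : ℕ}

theorem realHomogeneous (Q : Matrix (Fin N) (Fin N) ℂ) : RealHomogeneous (form Q) :=
  ⟨fun t v w => by rw [form_csmul_left, Complex.star_def, Complex.conj_ofReal],
    fun t v w => form_csmul_right Q v w t⟩

/-- The form is non-negative on the orthogonal complement in `T` of a negative definite subspace of
maximal dimension: a negative vector there would enlarge the subspace. -/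
theorem nonneg_of_orthogonal {Q : Matrix (Fin N) (Fin N) ℂ} (hQ : Qᴴ = Q)
    {T y : Submodule ℂ (Fin N → ℂ)} (hyT : y ≤ T) (hy : NegDef (form Q) y)
    (hdim : Module.finrank ℂ y = negIndex (form Q) T) {u : Fin N → ℂ} (hu : u ∈ T)
    (huy : ∀ v ∈ y, form Q v u = 0) : 0 ≤ (form Q u u).re := by
  by_contra! hlt
  have hspan : NegDef (form Q) (Submodule.span ℂ {u}) := by
    intro x hx hx0
    obtain ⟨c, rfl⟩ := Submodule.mem_span_singleton.1 hx
    have hc : c ≠ 0 := by rintro rfl; exact hx0 (zero_smul _ _)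
    rw [form_csmul_left, form_csmul_right, ← mul_assoc]
    have : star c * c = ((Complex.normSq c : ℝ) : ℂ) := by
      rw [mul_comm]; exact Complex.mul_conj c
    rw [this, Complex.re_ofReal_mul]
    exact mul_neg_of_pos_of_neg (Complex.normSq_pos.2 hc) hlt
  have o : ∀ v ∈ y, ∀ x ∈ Submodule.span ℂ {u}, form Q v x = 0 := by
    intro v hv x hx
    obtain ⟨c, rfl⟩ := Submodule.mem_span_singleton.1 hx
    rw [form_csmul_right, huy v hv, mul_zero]
  have hn := hy.sup (biadditive Q) hspan o
    fun v hv x hx => form_eq_zero_symm (Or.inl hQ) (o v hv x hx)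
  have hle := finrank_le_negIndex (h := form Q) (U := T)
    (sup_le hyT ((Submodule.span_singleton_le_iff_mem u T).2 hu)) hn
  have hd := Submodule.finrank_sup_add_finrank_inf_eq y (Submodule.span ℂ {u})
  rw [disjoint_iff.1 (hy.disjoint o), finrank_bot, finrank_span_singleton] at hd
  · omega
  · rintro rfl
    simp [form] at hlt

/-- A maximal negative definite subspace `z₀` of `U` has the orthogonal complement
`p = U ∩ z₀^⊥`, on which the form is non-negative, so `z₀` can be joined to any other point. -/
theorem joinedByFrames {Q : Matrix (Fin N) (Fin N) ℂ} (hQ : Qᴴ = Q)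
    {U : Submodule ℂᵐᵒᵖ (Fin N → ℂ)} {z₀ z₁ : Gr (Fin N → ℂ)} (hz₀ : z₀ ∈ D Q U)
    (hz₁ : z₁ ∈ D Q U) : JoinedByFrames (D Q U) z₀ z₁ := by
  obtain ⟨a1, a2, a3⟩ := hz₀
  obtain ⟨b1, b2, b3⟩ := hz₁
  -- `z₀` as a right vector space
  let Z : Submodule ℂᵐᵒᵖ (Fin N → ℂ) :=
    { carrier := (z₀ : Set (Fin N → ℂ))
      zero_mem' := Submodule.zero_mem _
      add_mem' := Submodule.add_mem _
      smul_mem' := by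
        intro c x hx
        have : c • x = c.unop • x := by ext i; simp [mul_comm]
        rw [SetLike.mem_coe, this]
        exact Submodule.smul_mem _ _ hx }
  have hZ : Nondeg Q Z := by
    intro w hw hw'
    by_contra h0
    have := a2 w hw h0
    rw [hw' w hw] at this
    exact lt_irrefl _ this
  let p : Submodule ℂ (Fin N → ℂ) := cx U ⊓ cx (orth Q Z)
  have o₁ : ∀ u ∈ z₀, ∀ v ∈ p, form Q u v = 0 :=
    fun u hu v hv => (Submodule.mem_inf.1 hv).2 u hu
  have hp : ∀ v ∈ p, 0 ≤ (form Q v v).re := fun v hv =>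
    nonneg_of_orthogonal hQ a1 a2 a3 (Submodule.mem_inf.1 hv).1 fun u hu => o₁ u hu v hv
  have hsup : z₁ ≤ z₀ ⊔ p := by
    intro x hx
    have hxt : x ∈ Z ⊔ orth Q Z := by rw [(isCompl_orth hZ).sup_eq_top]; trivial
    obtain ⟨u, hu, v, hv, rfl⟩ := Submodule.mem_sup.1 hxt
    refine Submodule.mem_sup.2 ⟨u, hu, v, ⟨?_, hv⟩, rfl⟩
    have h := (cx U).sub_mem (b1 hx) (a1 hu)
    rwa [add_sub_cancel_left] at h
  refine joinedByFrames_of_orthogonal (fun v => by fun_prop) (biadditive Q) (realHomogeneous Q) b2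
    (b3.trans a3.symm) hp o₁ (fun u hu v hv => form_eq_zero_symm (Or.inl hQ) (o₁ u hu v hv)) hsup ?_
  intro z t hdim hz hzx
  refine ⟨?_, hz, hdim.trans a3⟩
  intro x hx
  obtain ⟨u, hu, v, hv, -, rfl⟩ := hzx x hx
  exact (cx U).add_mem (a1 hu) ((cx U).smul_mem _ hv.1)

theorem Hn_map_rho_eq {Q : Matrix (Fin N) (Fin N) ℂ} (hQ : Qᴴ = Q)
    (Γ : Subgroup (Matrix (Fin N) (Fin N) ℂ)ˣ) {U : Submodule ℂᵐᵒᵖ (Fin N → ℂ)}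
    (hU : Nondeg Q U) (z' z'' : D Q U) (A : ModuleCat.{0} ℤ) (n : ℕ) :
    Hn.map A n (rho hQ Γ hU z') = Hn.map A n (rho hQ Γ hU z'') := by
  refine Hn_map_sumMap_eq act inf_le_left (E := D Q U) ?_ (fun _ h _ hz => sup_mem hQ hU h hz) ?_
    z'.2 z''.2 (joinedByFrames hQ z'.2 z''.2) A n
  · exact fun _ h _ hz => h.2.1.disjoint fun u hu _ hv => hz.1 hv u (h.1 hu)
  · intro z h g hg
    have hfix : ∀ v ∈ z, act g v = v := fun v hv => stab_fix (Or.inl hQ) hg (h.1 hv)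
    exact map_eq_self_of_fixed hfix

end CaseA

/-! ### Case B: complex conjugation -/

namespace CaseB

variable {N : ℕ}

theorem S_realHomogeneous (Q : Matrix (Fin N) (Fin N) ℝ) : RealHomogeneous (S Q) :=
  ⟨fun t v w => by simp [S], fun t v w => by simp [S, Matrix.mulVec_smul]⟩

theorem herm_realHomogeneous (Q : Matrix (Fin N) (Fin N) ℝ) : RealHomogeneous (herm Q) := by
  refine ⟨fun t v w => ?_, fun t v w => ?_⟩
  · have : star ((t : ℂ) • v) = (t : ℂ) • star v := by ext i; simp
    rw [herm, herm, this, (S_realHomogeneous Q).1]; ring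
  · rw [herm, herm, (S_realHomogeneous Q).2]; ring

theorem S_star_star (Q : Matrix (Fin N) (Fin N) ℝ) (v w : Fin N → ℂ) :
    S Q (star v) (star w) = star (S Q v w) := by
  simp only [S, dotProduct, Matrix.mulVec, star_sum, star_mul', Finset.mul_sum, Pi.star_apply,
    Matrix.map_apply]
  simp

theorem form_swap {Q : Matrix (Fin N) (Fin N) ℝ} (hQ : Qᵀ = -Q) (v w : Fin N → ℝ) :
    form Q w v = -form Q v w := by
  have h := form_star Q v w
  rw [Matrix.conjTranspose_eq_transpose_of_trivial, hQ, star_trivial] at h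
  rw [h]
  simp [form, Matrix.neg_mulVec]

theorem S_swap {Q : Matrix (Fin N) (Fin N) ℝ} (hQ : Qᵀ = -Q) (v w : Fin N → ℂ) :
    S Q w v = -S Q v w := by
  rw [S_eq, S_eq, form_swap hQ (fun i => (v i).re), form_swap hQ (fun i => (v i).im),
    form_swap hQ (fun i => (v i).re), form_swap hQ (fun i => (v i).im)]
  push_cast; ring

/-- Complex conjugation of `V ⊗ ℂ = ℂ ^ N`. -/
def conj : (Fin N → ℂ) →ₛₗ[starRingEnd ℂ] (Fin N → ℂ) where
  toFun := star
  map_add' := star_add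
  map_smul' c v := star_smul c v

theorem joinedByFrames {Q : Matrix (Fin N) (Fin N) ℝ} (hQ : Qᵀ = -Q)
    {U : Submodule ℝᵐᵒᵖ (Fin N → ℝ)} {z₀ z₁ : Gr (Fin N → ℂ)} (hz₀ : z₀ ∈ D Q U)
    (hz₁ : z₁ ∈ D Q U) : JoinedByFrames (D Q U) z₀ z₁ := by
  refine lagrangianDomain_joinedByFrames (fun v => by fun_prop) (herm_biadditive Q)
    (herm_realHomogeneous Q) (S_biadditive Q) (S_realHomogeneous Q) conj star_injective
    ?_ ?_ ?_ ?_ (fun v hv => star_mem hv) hz₀ hz₁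
  · intro v
    change (Complex.I * S Q (star (star v)) (star v)).re = -(Complex.I * S Q (star v) v).re
    rw [star_star, S_swap hQ (star v) v, mul_neg, Complex.neg_re]
  · intro v w h
    change S Q (star v) (star w) = 0
    rw [S_star_star, h, star_zero]
  · intro v w h _
    change Complex.I * S Q (star v) (star w) = 0
    rw [S_star_star, h, star_zero, mul_zero]
  · intro v w _ h
    change Complex.I * S Q (star (star w)) v = 0
    rw [star_star, h, mul_zero]

theorem Hn_map_rho_eq {Q : Matrix (Fin N) (Fin N) ℝ} (hQ : Qᵀ = -Q)
    (Γ : Subgroup (Matrix (Fin N) (Fin N) ℝ)ˣ) {U : Submodule ℝᵐᵒᵖ (Fin N → ℝ)}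
    (hU : Nondeg Q U) (z' z'' : D Q U) (A : ModuleCat.{0} ℤ) (n : ℕ) :
    Hn.map A n (rho hQ Γ hU z') = Hn.map A n (rho hQ Γ hU z'') := by
  refine Hn_map_sumMap_eq act inf_le_left (E := D Q U) ?_ (fun _ h _ hz => sup_mem hQ hU h hz) ?_
    z'.2 z''.2 (joinedByFrames hQ z'.2 z''.2) A n
  · exact fun _ h _ hz => h.2.2.1.disjoint fun _ hu _ hv =>
      herm_eq_zero (U := U) (U' := orth Q U) (fun u hu v hv => hv u hu) (h.1 hu) (hz.1 hv)
  · intro z h g hg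
    have hfix : ∀ v ∈ z, act g v = v := fun v hv => act_fix hQ hg (h.1 hv)
    exact map_eq_self_of_fixed hfix

end CaseB

/-! ### Case C: right multiplication by `j` -/

namespace CaseC

variable {N : ℕ}

theorem H_realHomogeneous (Q : Matrix (Fin N) (Fin N) ℍ[ℝ]) : RealHomogeneous (H Q) := by
  have hreal : ∀ t : ℝ, toH (t : ℂ) = (t : ℍ[ℝ]) := fun t => by simp [toH]
  refine ⟨fun t v w => ?_, fun t v w => ?_⟩
  · have : form Q ((t : ℂ) • v : HSpace N) w = star (toH t) * form Q v w :=
      form_smul_left Q v w (MulOpposite.op (toH t))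
    rw [hreal] at this
    rw [H, H, this]
    apply Complex.ext <;> simp
  · have : form Q v ((t : ℂ) • w : HSpace N) = form Q v w * toH t :=
      form_smul_right Q v w (MulOpposite.op (toH t))
    rw [hreal] at this
    rw [H, H, this]
    apply Complex.ext <;> simp [mul_comm]

/-- The quaternion `j`. -/
def unitJ : ℍ[ℝ] := ⟨0, 0, 1, 0⟩

@[simp] theorem unitJ_re : unitJ.re = 0 := rfl
@[simp] theorem unitJ_imI : unitJ.imI = 0 := rfl
@[simp] theorem unitJ_imJ : unitJ.imJ = 1 := rfl
@[simp] theorem unitJ_imK : unitJ.imK = 0 := rfl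

theorem mulJ_apply (v : HSpace N) (i : Fin N) : mulJ v i = v i * unitJ := rfl

theorem mulJ_smul (c : ℂ) (v : HSpace N) : mulJ (c • v) = starRingEnd ℂ c • mulJ v := by
  funext i
  simp only [mulJ_apply, smul_apply, mul_assoc]
  congr 1
  ext <;> simp [toH]

theorem mulJ_mulJ (v : HSpace N) : mulJ (mulJ v) = -v := by
  funext i
  change v i * unitJ * unitJ = -v i
  ext <;> simp

theorem S_realHomogeneous (Q : Matrix (Fin N) (Fin N) ℍ[ℝ]) : RealHomogeneous (S Q) := by
  refine ⟨fun t v w => ?_, fun t v w => (H_realHomogeneous Q).2 t _ w⟩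
  rw [S, mulJ_smul, Complex.conj_ofReal]
  exact (H_realHomogeneous Q).1 t _ w

theorem herm_realHomogeneous (Q : Matrix (Fin N) (Fin N) ℍ[ℝ]) : RealHomogeneous (herm Q) :=
  ⟨fun t v w => by rw [herm, herm, (H_realHomogeneous Q).1]; ring,
    fun t v w => by rw [herm, herm, (H_realHomogeneous Q).2]; ring⟩

theorem form_mulJ_left (Q : Matrix (Fin N) (Fin N) ℍ[ℝ]) (v w : HSpace N) :
    form Q (mulJ v) w = star unitJ * form Q v w :=
  form_smul_left Q v w (MulOpposite.op unitJ)

theorem form_mulJ_right (Q : Matrix (Fin N) (Fin N) ℍ[ℝ]) (v w : HSpace N) :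
    form Q v (mulJ w) = form Q v w * unitJ :=
  form_smul_right Q v w (MulOpposite.op unitJ)

/-- The form `S(v, w)` records the `j`- and `k`-components of `(v, w)`. -/
theorem S_eq (Q : Matrix (Fin N) (Fin N) ℍ[ℝ]) (v w : HSpace N) :
    S Q v w = ⟨(form Q v w).imJ, -(form Q v w).imK⟩ := by
  apply Complex.ext <;> simp [S, H, form_mulJ_left]

theorem H_mulJ_right (Q : Matrix (Fin N) (Fin N) ℍ[ℝ]) (v w : HSpace N) :
    H Q v (mulJ w) = -star (S Q v w) := by
  rw [S_eq]
  apply Complex.ext <;> simp [H, form_mulJ_right]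

theorem H_mulJ_mulJ (Q : Matrix (Fin N) (Fin N) ℍ[ℝ]) (v w : HSpace N) :
    H Q (mulJ v) (mulJ w) = star (H Q v w) := by
  apply Complex.ext <;> simp [H, form_mulJ_left, form_mulJ_right]

theorem S_mulJ_mulJ (Q : Matrix (Fin N) (Fin N) ℍ[ℝ]) (v w : HSpace N) :
    S Q (mulJ v) (mulJ w) = star (S Q v w) :=
  H_mulJ_mulJ Q (mulJ v) w


/-- Right multiplication by `j`, as a conjugate-linear map of the complex vector space `ℍ ^ N`. -/
def mulJₛₗ : HSpace N →ₛₗ[starRingEnd ℂ] HSpace N where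
  toFun := mulJ
  map_add' := mulJ_add
  map_smul' := mulJ_smul

theorem continuous_ofReal_smul (v : HSpace N) : Continuous fun t : ℝ => (t : ℂ) • v := by
  have h : ∀ t : ℝ, toH (t : ℂ) = (t : ℍ[ℝ]) := fun t => by simp [toH]
  refine continuous_pi fun i => ?_
  change Continuous fun t : ℝ => v i * toH (t : ℂ)
  simp only [h]
  exact continuous_const.mul Quaternion.continuous_coe

theorem joinedByFrames {Q : Matrix (Fin N) (Fin N) ℍ[ℝ]}
    {U : Submodule ℍ[ℝ]ᵐᵒᵖ (Fin N → ℍ[ℝ])} {z₀ z₁ : Gr (HSpace N)} (hz₀ : z₀ ∈ D Q U)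
    (hz₁ : z₁ ∈ D Q U) : JoinedByFrames (D Q U) z₀ z₁ := by
  refine lagrangianDomain_joinedByFrames continuous_ofReal_smul (herm_biadditive Q)
    (herm_realHomogeneous Q) (S_biadditive Q) (S_realHomogeneous Q) mulJₛₗ ?_
    ?_ ?_ ?_ ?_ (fun v hv => U.smul_mem (MulOpposite.op unitJ) hv) hz₀ hz₁
  · intro v w h
    have h' := congrArg mulJ (show mulJ v = mulJ w from h)
    rwa [mulJ_mulJ, mulJ_mulJ, neg_inj] at h'
  · intro v
    change (Complex.I * H Q (mulJ v) (mulJ v)).re = -(Complex.I * H Q v v).re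
    rw [H_mulJ_mulJ]
    simp
  · intro v w h
    change S Q (mulJ v) (mulJ w) = 0
    rw [S_mulJ_mulJ, h, star_zero]
  · intro v w h _
    change Complex.I * H Q v (mulJ w) = 0
    rw [H_mulJ_right, h, star_zero, neg_zero, mul_zero]
  · intro v w _ h
    change Complex.I * S Q w v = 0
    rw [h, mul_zero]

theorem Hn_map_rho_eq {Q : Matrix (Fin N) (Fin N) ℍ[ℝ]} (hQ : Qᴴ = -Q)
    (Γ : Subgroup (Matrix (Fin N) (Fin N) ℍ[ℝ])ˣ) {U : Submodule ℍ[ℝ]ᵐᵒᵖ (Fin N → ℍ[ℝ])}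
    (hU : Nondeg Q U) (z' z'' : D Q U) (A : ModuleCat.{0} ℤ) (n : ℕ) :
    Hn.map A n (rho hQ Γ hU z') = Hn.map A n (rho hQ Γ hU z'') := by
  refine Hn_map_sumMap_eq act inf_le_left (E := D Q U) ?_ (fun _ h _ hz => sup_mem hQ hU h hz) ?_
    z'.2 z''.2 (joinedByFrames z'.2 z''.2) A n
  · exact fun _ h _ hz => h.2.2.1.disjoint fun _ hu _ hv =>
      herm_eq_zero (U := U) (U' := orth Q U) (fun u hu v hv => hv u hu) (h.1 hu) (hz.1 hv)
  · intro z h g hg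
    have hfix : ∀ v ∈ z, act g v = v := fun v hv => stab_fix (Or.inr hQ) hg (h.1 hv)
    exact map_eq_self_of_fixed hfix

end CaseC

end

end SpecialCycle

theorem mainTheorem7 :
    -- Case A: `B = ℂ`, Hermitian form, `G = U(p, q)`
    (∀ (N : ℕ) (Q : Matrix (Fin N) (Fin N) ℂ) (hQ : Qᴴ = Q) (_ : SpecialCycle.Nondeg Q ⊤)
      (Γ : Subgroup (Matrix (Fin N) (Fin N) ℂ)ˣ) (_ : Γ ≤ SpecialCycle.isometryGroup Q)
      (U : Submodule ℂᵐᵒᵖ (Fin N → ℂ)) (hU : SpecialCycle.Nondeg Q U)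
      (z' z'' : SpecialCycle.CaseA.D Q U),
      (∀ (n : ℕ) (μ : SpecialCycle.Hn (ModuleCat.of ℤ ℤ) n (SpecialCycle.CaseA.MU Q Γ U)),
        SpecialCycle.IsFundamentalClass n (SpecialCycle.CaseA.MU Q Γ U) μ →
        SpecialCycle.cycleClass (SpecialCycle.CaseA.rho hQ Γ hU z') μ =
          SpecialCycle.cycleClass (SpecialCycle.CaseA.rho hQ Γ hU z'') μ) ∧
      ∀ (A : ModuleCat.{0} ℤ) (n : ℕ),
        SpecialCycle.Hn.map A n (SpecialCycle.CaseA.rho hQ Γ hU z') =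
          SpecialCycle.Hn.map A n (SpecialCycle.CaseA.rho hQ Γ hU z'')) ∧
    -- Case B: `B = ℝ`, symplectic form, `G = Sp(2n, ℝ)`
    (∀ (N : ℕ) (Q : Matrix (Fin N) (Fin N) ℝ) (hQ : Qᵀ = -Q) (_ : SpecialCycle.Nondeg Q ⊤)
      (Γ : Subgroup (Matrix (Fin N) (Fin N) ℝ)ˣ) (_ : Γ ≤ SpecialCycle.isometryGroup Q)
      (U : Submodule ℝᵐᵒᵖ (Fin N → ℝ)) (hU : SpecialCycle.Nondeg Q U)
      (z' z'' : SpecialCycle.CaseB.D Q U),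
      (∀ (n : ℕ) (μ : SpecialCycle.Hn (ModuleCat.of ℤ ℤ) n (SpecialCycle.CaseB.MU Q Γ U)),
        SpecialCycle.IsFundamentalClass n (SpecialCycle.CaseB.MU Q Γ U) μ →
        SpecialCycle.cycleClass (SpecialCycle.CaseB.rho hQ Γ hU z') μ =
          SpecialCycle.cycleClass (SpecialCycle.CaseB.rho hQ Γ hU z'') μ) ∧
      ∀ (A : ModuleCat.{0} ℤ) (n : ℕ),
        SpecialCycle.Hn.map A n (SpecialCycle.CaseB.rho hQ Γ hU z') =
          SpecialCycle.Hn.map A n (SpecialCycle.CaseB.rho hQ Γ hU z'')) ∧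
    -- Case C: `B = ℍ`, skew-Hermitian form, `G = O*(2n)`
    (∀ (N : ℕ) (Q : Matrix (Fin N) (Fin N) ℍ[ℝ]) (hQ : Qᴴ = -Q) (_ : SpecialCycle.Nondeg Q ⊤)
      (Γ : Subgroup (Matrix (Fin N) (Fin N) ℍ[ℝ])ˣ) (_ : Γ ≤ SpecialCycle.isometryGroup Q)
      (U : Submodule ℍ[ℝ]ᵐᵒᵖ (Fin N → ℍ[ℝ])) (hU : SpecialCycle.Nondeg Q U)
      (z' z'' : SpecialCycle.CaseC.D Q U),
      (∀ (n : ℕ) (μ : SpecialCycle.Hn (ModuleCat.of ℤ ℤ) n (SpecialCycle.CaseC.MU Q Γ U)),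
        SpecialCycle.IsFundamentalClass n (SpecialCycle.CaseC.MU Q Γ U) μ →
        SpecialCycle.cycleClass (SpecialCycle.CaseC.rho hQ Γ hU z') μ =
          SpecialCycle.cycleClass (SpecialCycle.CaseC.rho hQ Γ hU z'') μ) ∧
      ∀ (A : ModuleCat.{0} ℤ) (n : ℕ),
        SpecialCycle.Hn.map A n (SpecialCycle.CaseC.rho hQ Γ hU z') =
          SpecialCycle.Hn.map A n (SpecialCycle.CaseC.rho hQ Γ hU z'')) := by
  refine ⟨fun N Q hQ _ Γ _ U hU z' z'' => ?_, fun N Q hQ _ Γ _ U hU z' z'' => ?_,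
    fun N Q hQ _ Γ _ U hU z' z'' => ?_⟩
  · have h := SpecialCycle.CaseA.Hn_map_rho_eq hQ Γ hU z' z''
    exact ⟨fun n μ _ => by rw [SpecialCycle.cycleClass, h, SpecialCycle.cycleClass], h⟩
  · have h := SpecialCycle.CaseB.Hn_map_rho_eq hQ Γ hU z' z''
    exact ⟨fun n μ _ => by rw [SpecialCycle.cycleClass, h, SpecialCycle.cycleClass], h⟩
  · have h := SpecialCycle.CaseC.Hn_map_rho_eq hQ Γ hU z' z''
    exact ⟨fun n μ _ => by rw [SpecialCycle.cycleClass, h, SpecialCycle.cycleClass], h⟩
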